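/- Call a point $x$ of a connected topological space $X$ a cut point of $X$ if $X\setminus\{x\}$ is disconnected (that is, a union of two disjoint nonempty relatively open sets), and call $X$ a cut-point space if $X$ is connected and every point of $X$ is a cut point of $X$. A continuum is a connected compact Hausdorff space; a continuum $Y$ is reducible if for all $a,b\in Y$ there is a proper subcontinuum of $Y$ (a subset $K\subsetneq Y$ which is a continuum in the subspace topology) containing both $a$ and $b$. Theorem. Let $X$ be a separable metrizable cut-point space. Then there exist a metrizable continuum $Y$ and a topological embedding $e\colon X\to Y$ with dense image such that $Y$ is reducible, $Y$ has no cut points, and the remainder $Y\setminus e(X)$ is path-connected (and nonempty). -/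

import Mathlib

open Set TopologicalSpace

universe u

namespace Continua

/-- A point `x` is a cut point of `X` if its complement is disconnected. The empty set does not
count as disconnected, so the point of a one-point space is not a cut point. -/
def IsCutPoint {X : Type u} [TopologicalSpace X] (x : X) : Prop :=
  ¬ IsPreconnected ({x}ᶜ : Set X)

/-- A cut-point space is a connected space in which every point is a cut point. -/
structure IsCutPointSpace (X : Type u) [TopologicalSpace X] : Prop where
  connected : ConnectedSpace X
  cut : ∀ x : X, IsCutPoint x

/-- A continuum is a connected compact Hausdorff space. -/
structure IsContinuum (Y : Type u) [TopologicalSpace Y] : Prop where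
  connected : ConnectedSpace Y
  compact : CompactSpace Y
  hausdorff : T2Space Y

/-- A continuum is reducible if any two of its points lie in a proper subcontinuum, that is, in
a proper subset which is a continuum in the subspace topology. -/
def IsReducible (Y : Type u) [TopologicalSpace Y] : Prop :=
  ∀ a b : Y, ∃ K : Set Y, IsContinuum K ∧ K ≠ univ ∧ a ∈ K ∧ b ∈ K

end Continua

/-! No side of a cut point of X, taken together with the point, is compact
(`Separates.not_isCompact`), so in any compactification of X the closure of each side reaches the
remainder. If the remainder is connected, it therefore ties the two sides together and no point of X
cuts the compactification; a point of the remainder does not cut it since X is connected and dense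
(`IsCutPointSpace.not_isCutPoint`). For reducibility (`IsCutPointSpace.isReducible`), a point of X
off the closure of the remainder lies in proper subcontinua made of one side and the closure of the
remainder. Two points in the closure of the remainder are joined by two paths that meet X at most at
their ends.

What is left is a metrizable compactification in which each point of the closure of the remainder
can be reached from a base point by such a path (`exists_compactification`). It is the closure of X
in a product of two cubes under two families of functions. Those of the first have compact supports
and generate the topology where X is locally compact; they vanish on the remainder. The second
family h generates the topology at the other points and has the truncation property: with y, also
(y_0, ..., y_{m-1}, τ y_m, 0, 0, ...) is a limit of points of X. Such a truncation is never a point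
of X, because a point of X where the first family vanishes has infinitely many positive coordinates.
The path from 0 to y raises the coordinates one after the other, so before its end it consists of
truncations.

The truncation property is forced coordinate by coordinate (`Stage.exists_extends`,
`exists_coordinates`). Near points without compact neighbourhoods there are infinite closed discrete
sets. Bumps give h a dense set of prescribed values there; these values are then frozen, and later
coordinates are kept small at those points. -/

namespace Continua

/-! ### Cut points and the non-compactness of their sides. -/

section CutPoints

variable {X : Type u} [TopologicalSpace X]

/-- `A` and `B` separate the complement of the point `x`. -/
structure Separates (x : X) (A B : Set X) : Prop where
  isOpen_left : IsOpen A
  isOpen_right : IsOpen B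
  nonempty_left : A.Nonempty
  nonempty_right : B.Nonempty
  disjoint : Disjoint A B
  union : A ∪ B = {x}ᶜ

theorem Separates.symm {x : X} {A B : Set X} (h : Separates x A B) : Separates x B A :=
  ⟨h.isOpen_right, h.isOpen_left, h.nonempty_right, h.nonempty_left, h.disjoint.symm,
    by rw [union_comm, h.union]⟩

theorem Separates.mem_cases {x : X} {A B : Set X} (h : Separates x A B) (z : X) :
    z = x ∨ z ∈ A ∨ z ∈ B := by
  by_cases hz : z = x
  · exact Or.inl hz
  · have : z ∈ A ∪ B := by rw [h.union]; exact hz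
    exact Or.inr this

theorem Separates.notMem_left {x : X} {A B : Set X} (h : Separates x A B) : x ∉ A := by
  intro hx
  have : x ∈ A ∪ B := Or.inl hx
  rw [h.union] at this
  exact this rfl

theorem Separates.compl_left {x : X} {A B : Set X} (h : Separates x A B) :
    Aᶜ = insert x B := by
  ext z
  have h1 := h.notMem_left
  have h2 := h.mem_cases z
  have h3 : z ∈ A → z ∉ B := fun hA => disjoint_left.1 h.disjoint hA
  simp only [mem_compl_iff, mem_insert_iff]
  constructor
  · tauto
  · rintro (rfl | hB)
    · exact h1
    · tauto

theorem Separates.isClosed_insert {x : X} {A B : Set X} (h : Separates x A B) :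
    IsClosed (insert x A) := by
  rw [← h.symm.compl_left]
  exact h.isOpen_right.isClosed_compl

theorem IsCutPoint.exists_separates [T1Space X] {x : X} (hx : IsCutPoint x) :
    ∃ A B, Separates x A B := by
  have ho : IsOpen ({x}ᶜ : Set X) := isOpen_compl_singleton
  simp only [IsCutPoint, IsPreconnected, not_forall] at hx
  obtain ⟨u, v, hu, hv, huv, h1, h2, h3⟩ := hx
  refine ⟨{x}ᶜ ∩ u, {x}ᶜ ∩ v, ho.inter hu, ho.inter hv, h1, h2, ?_, ?_⟩
  · rw [disjoint_left]
    intro z hz hz'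
    exact h3 ⟨z, hz.1, hz.2, hz'.2⟩
  · rw [← inter_union_distrib_left, inter_eq_left]
    exact huv

theorem Separates.mem_closure [PreconnectedSpace X] {x : X} {A B : Set X}
    (h : Separates x A B) : x ∈ closure A := by
  by_contra hx
  have hcl : IsClosed A := by
    refine isClosed_of_closure_subset fun z hz => ?_
    have : z ∈ insert x A := closure_minimal (subset_insert _ _) h.isClosed_insert hz
    rcases this with rfl | h'
    · exact absurd hz hx
    · exact h'
  have := IsClopen.eq_univ ⟨hcl, h.isOpen_left⟩ h.nonempty_left
  exact h.notMem_left (this ▸ mem_univ x)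

/-- A relatively clopen piece of `insert x A` that misses x is clopen in X: closed since `insert x
A` is closed, open since it is cut out of the open set A. -/
theorem Separates.isPreconnected_insert [PreconnectedSpace X] {x : X} {A B : Set X}
    (h : Separates x A B) : IsPreconnected (insert x A) := by
  have key : ∀ P Q : Set X, IsClosed P → IsClosed Q → insert x A ⊆ P ∪ Q →
      x ∈ P → (insert x A ∩ Q).Nonempty → (insert x A ∩ (P ∩ Q)).Nonempty := by
    intro P Q hP hQ hPQ hxP hne
    by_contra hemp
    have hdis : ∀ z ∈ insert x A, z ∈ P → z ∉ Q := fun z hz hzP hzQ => hemp ⟨z, hz, hzP, hzQ⟩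
    have hxQ : x ∉ Q := hdis x (mem_insert _ _) hxP
    have heq : insert x A ∩ Q = A ∩ Pᶜ := by
      ext z
      constructor
      · rintro ⟨hz, hzQ⟩
        rcases hz with rfl | hz
        · exact absurd hzQ hxQ
        · exact ⟨hz, fun hzP => hdis z (Or.inr hz) hzP hzQ⟩
      · rintro ⟨hz, hzP⟩
        exact ⟨Or.inr hz, (hPQ (Or.inr hz)).resolve_left hzP⟩
    have hclopen : IsClopen (insert x A ∩ Q) :=
      ⟨h.isClosed_insert.inter hQ, by rw [heq]; exact h.isOpen_left.inter hP.isOpen_compl⟩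
    have := hclopen.eq_univ hne
    exact hxQ (this.ge (mem_univ x)).2
  rw [isPreconnected_closed_iff]
  intro P Q hP hQ hPQ hneP hneQ
  rcases hPQ (mem_insert x A) with hx | hx
  · exact key P Q hP hQ hPQ hx hneQ
  · rw [inter_comm P Q]
    exact key Q P hQ hP (by rwa [union_comm]) hx hneP

/-- Every side of a cut point of a cut-point space is non-compact: otherwise a minimal side would
contain a non-cut point. -/
theorem Separates.not_isCompact [T1Space X] [PreconnectedSpace X]
    (hX : ∀ x : X, IsCutPoint x) {x : X} {A B : Set X} (h : Separates x A B) :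
    ¬ IsCompact (insert x A) := by
  intro hcomp
  let 𝓕 : Set (Set X) := {V | V ⊆ A ∧ V.Nonempty ∧ Vᶜ.Nonempty ∧ IsPreconnected Vᶜ}
  -- The connected complements of the members miss q, so each lies on one side of q, and by nesting
  -- all lie on the same side C. The other side D, even with q added, then lies in every member.
  have shrink : ∀ q : X, ∀ c : Set (Set X), c ⊆ 𝓕 → c.Nonempty → (∀ V ∈ c, q ∈ V) →
      (∀ V ∈ c, ∀ W ∈ c, V ⊆ W ∨ W ⊆ V) →
      ∃ D ∈ 𝓕, q ∉ D ∧ ∀ V ∈ c, closure D ⊆ V := by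
    intro q c hc hne hq hchain
    obtain ⟨C, D, hCD⟩ := (hX q).exists_separates
    obtain ⟨V₀, hV₀⟩ := hne
    have side : ∀ V ∈ c, Vᶜ ⊆ C ∨ Vᶜ ⊆ D := by
      intro V hV
      refine (hc hV).2.2.2.subset_or_subset hCD.isOpen_left hCD.isOpen_right hCD.disjoint ?_
      rw [hCD.union]
      intro z hz hzq
      rw [mem_singleton_iff] at hzq
      exact hz (hzq ▸ hq V hV)
    have fin : ∀ C D : Set X, Separates q C D → (∀ V ∈ c, Vᶜ ⊆ C ∨ Vᶜ ⊆ D) → V₀ᶜ ⊆ C →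
        ∃ D ∈ 𝓕, q ∉ D ∧ ∀ V ∈ c, closure D ⊆ V := by
      intro C D hCD side h0
      have hall : ∀ V ∈ c, Vᶜ ⊆ C := by
        intro V hV
        refine (side V hV).resolve_right fun hD => ?_
        rcases hchain V hV V₀ hV₀ with hle | hle
        · obtain ⟨z, hz⟩ := (hc hV₀).2.2.1
          exact disjoint_left.1 hCD.disjoint (h0 hz) (hD (compl_subset_compl.2 hle hz))
        · obtain ⟨z, hz⟩ := (hc hV).2.2.1
          exact disjoint_left.1 hCD.disjoint (h0 (compl_subset_compl.2 hle hz)) (hD hz)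
      have hsub : ∀ V ∈ c, insert q D ⊆ V := by
        intro V hV
        rw [← hCD.compl_left]
        exact compl_subset_comm.1 (hall V hV)
      refine ⟨D, ⟨?_, hCD.nonempty_right, ⟨q, hCD.symm.notMem_left⟩, ?_⟩,
        hCD.symm.notMem_left, fun V hV => ?_⟩
      · exact (subset_insert _ _).trans ((hsub V₀ hV₀).trans (hc hV₀).1)
      · rw [hCD.symm.compl_left]
        exact hCD.isPreconnected_insert
      · exact (closure_minimal (subset_insert _ _) hCD.symm.isClosed_insert).trans (hsub V hV)
    rcases side V₀ hV₀ with h0 | h0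
    · exact fin C D hCD side h0
    · exact fin D C hCD.symm (fun V hV => (side V hV).symm) h0
  -- With closures in the order, each member of a chain without a last element contains the closure
  -- of another member. A common point of the closures, given by compactness, thus lies in all
  -- members, as `shrink` needs.
  let r : 𝓕 → 𝓕 → Prop := fun V W => W = V ∨ closure (W : Set X) ⊆ V
  have hr : ∀ {V W : 𝓕}, r V W → (W : Set X) ⊆ V := by
    rintro V W (rfl | hVW)
    · exact subset_rfl
    · exact subset_closure.trans hVW
  have hA : A ∈ 𝓕 := ⟨subset_rfl, h.nonempty_left, ⟨x, h.notMem_left⟩, by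
    rw [h.compl_left]; exact h.symm.isPreconnected_insert⟩
  obtain ⟨M, hM⟩ : ∃ M : 𝓕, ∀ V, r M V → r V M := by
    refine exists_maximal_of_chains_bounded (r := r) ?_ ?_
    · intro c hc
      rcases c.eq_empty_or_nonempty with rfl | hne
      · exact ⟨⟨A, hA⟩, fun V hV => absurd hV (notMem_empty V)⟩
      by_cases hmax : ∃ V ∈ c, ∀ W ∈ c, r W V
      · obtain ⟨V, -, hV⟩ := hmax
        exact ⟨V, hV⟩
      push Not at hmax
      have hstrict : ∀ V ∈ c, ∃ W ∈ c, closure (W : Set X) ⊆ V := by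
        intro V hV
        obtain ⟨W, hW, hn⟩ := hmax V hV
        have hVW : V ≠ W := by
          rintro rfl
          exact hn (Or.inl rfl)
        rcases hc hV hW hVW with h' | h'
        · exact ⟨W, hW, h'.resolve_left hVW.symm⟩
        · exact absurd h' hn
      have hcl : ∀ V : 𝓕, closure (V : Set X) ⊆ insert x A := fun V =>
        closure_minimal (V.2.1.trans (subset_insert _ _)) h.isClosed_insert
      have : Nonempty c := hne.to_subtype
      obtain ⟨q, hq⟩ : (⋂ V : c, closure ((V : 𝓕) : Set X)).Nonempty := by
        refine IsCompact.nonempty_iInter_of_directed_nonempty_isCompact_isClosed _ ?_ ?_ ?_ ?_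
        · rintro ⟨V, hV⟩ ⟨W, hW⟩
          by_cases hVW : V = W
          · subst hVW
            exact ⟨⟨V, hV⟩, subset_rfl, subset_rfl⟩
          rcases hc hV hW hVW with h' | h'
          · exact ⟨⟨W, hW⟩, closure_mono (hr h'), subset_rfl⟩
          · exact ⟨⟨V, hV⟩, subset_rfl, closure_mono (hr h')⟩
        · exact fun V => (V : 𝓕).2.2.1.mono subset_closure
        · exact fun V => hcomp.of_isClosed_subset isClosed_closure (hcl V)
        · exact fun V => isClosed_closure
      obtain ⟨D, hD, -, hDV⟩ := shrink q (Subtype.val '' c)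
        (by rintro _ ⟨V, -, rfl⟩; exact V.2) (hne.image _)
        (by
          rintro _ ⟨V, hV, rfl⟩
          obtain ⟨W, hW, hWV⟩ := hstrict V hV
          exact hWV (mem_iInter.1 hq ⟨W, hW⟩))
        (by
          rintro _ ⟨V, hV, rfl⟩ _ ⟨W, hW, rfl⟩
          by_cases hVW : V = W
          · exact Or.inl (hVW ▸ subset_rfl)
          rcases hc hV hW hVW with h' | h'
          · exact Or.inr (hr h')
          · exact Or.inl (hr h'))
      exact ⟨⟨D, hD⟩, fun V hV => Or.inr (hDV V ⟨V, hV, rfl⟩)⟩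
    · intro U V W hUV hVW
      rcases hVW with rfl | hVW
      · exact hUV
      · exact Or.inr (hVW.trans (hr hUV))
  obtain ⟨q, hq⟩ := M.2.2.1
  obtain ⟨D, hD, hqD, hDM⟩ := shrink q {(M : Set X)} (by simp) (singleton_nonempty _)
    (by simpa using hq) (by simp)
  exact hqD (hr (hM ⟨D, hD⟩ (Or.inr (hDM _ rfl))) hq)

end CutPoints

/-! ### Compactifications of cut-point spaces. -/

section Compactification

variable {X : Type u} [TopologicalSpace X] {Y : Type u} [TopologicalSpace Y]

theorem IsContinuum.of_set [T2Space Y] {K : Set Y} (hK : IsCompact K) (hc : IsConnected K) :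
    IsContinuum K :=
  ⟨isConnected_iff_connectedSpace.1 hc, isCompact_iff_compactSpace.1 hK, inferInstance⟩

/-- The closure of a non-compact closed set in a compactification meets the remainder. -/
theorem closure_image_inter_compl_range_nonempty [CompactSpace Y] {e : X → Y}
    (he : IsDenseEmbedding e) {C : Set X} (hC : IsClosed C) (hn : ¬ IsCompact C) :
    (closure (e '' C) ∩ (range e)ᶜ).Nonempty := by
  by_contra hemp
  have hsub : closure (e '' C) ⊆ range e := fun y hy => by
    by_contra hy'
    exact hemp ⟨y, hy, hy'⟩
  have heq : e '' C = closure (e '' C) := by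
    refine subset_closure.antisymm fun y hy => ?_
    obtain ⟨x, rfl⟩ := hsub hy
    have : x ∈ closure C := by
      rw [he.isEmbedding.closure_eq_preimage_closure_image]
      exact hy
    exact ⟨x, hC.closure_eq ▸ this, rfl⟩
  refine hn (he.isEmbedding.isCompact_iff.2 ?_)
  rw [heq]
  exact isClosed_closure.isCompact

/-- A compactification of a cut-point space with connected remainder has no cut points. -/
theorem IsCutPointSpace.not_isCutPoint [T1Space X] [CompactSpace Y] [T2Space Y]
    (hX : IsCutPointSpace X) {e : X → Y} (he : IsDenseEmbedding e)
    (hconn : IsPreconnected (range e)ᶜ) (y : Y) : ¬ IsCutPoint y := by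
  intro hy
  have := hX.connected
  obtain ⟨A, B, hAB⟩ := hy.exists_separates
  by_cases hyX : y ∈ range e
  · obtain ⟨x, rfl⟩ := hyX
    have hsep : Separates x (e ⁻¹' A) (e ⁻¹' B) := by
      refine ⟨hAB.isOpen_left.preimage he.continuous, hAB.isOpen_right.preimage he.continuous,
        ?_, ?_, hAB.disjoint.preimage e, ?_⟩
      · obtain ⟨z, hz⟩ := he.dense.exists_mem_open hAB.isOpen_left hAB.nonempty_left
        exact ⟨z, hz⟩
      · obtain ⟨z, hz⟩ := he.dense.exists_mem_open hAB.isOpen_right hAB.nonempty_right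
        exact ⟨z, hz⟩
      · rw [← preimage_union, hAB.union]
        ext z
        simp [he.injective.eq_iff]
    have meets : ∀ A B : Set Y, Separates (e x) A B → Separates x (e ⁻¹' A) (e ⁻¹' B) →
        ((range e)ᶜ ∩ A).Nonempty := by
      intro A B hAB hsep
      obtain ⟨z, hz, hzX⟩ := closure_image_inter_compl_range_nonempty he hsep.isClosed_insert
        (hsep.not_isCompact hX.cut)
      have hsub : closure (e '' insert x (e ⁻¹' A)) ⊆ insert (e x) A := by
        refine closure_minimal ?_ hAB.isClosed_insert
        rintro _ ⟨w, rfl | hw, rfl⟩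
        · exact Or.inl rfl
        · exact Or.inr hw
      rcases hsub hz with rfl | hzA
      · exact absurd ⟨x, rfl⟩ hzX
      · exact ⟨z, hzX, hzA⟩
    obtain ⟨z, -, hz⟩ := hconn A B hAB.isOpen_left hAB.isOpen_right
      (by
        rw [hAB.union]
        rintro z hz rfl
        exact hz ⟨x, rfl⟩)
      (meets A B hAB hsep) (meets B A hAB.symm hsep.symm)
    exact disjoint_left.1 hAB.disjoint hz.1 hz.2
  · refine hy ((isPreconnected_range he.continuous).subset_closure (t := {y}ᶜ) ?_ ?_)
    · rintro z hz rfl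
      exact hyX hz
    · rw [he.dense.closure_range]
      exact subset_univ _

/-- If all points of the closure of the remainder of a compactification of a cut-point space are
joined by paths within the remainder to a base point, then the compactification is reducible. -/
theorem IsCutPointSpace.isReducible [T1Space X] [CompactSpace Y] [T2Space Y]
    (hX : IsCutPointSpace X) {e : X → Y} (he : IsDenseEmbedding e) {o : Y}
    (hpath : ∀ a ∈ closure (range e)ᶜ, ∃ γ : Path o a, ∀ t, γ t ∈ range e → γ t = a)
    (hconn : IsConnected (range e)ᶜ) : IsReducible Y := by
  have := hX.connected
  have : Nontrivial X := by
    obtain ⟨x⟩ : Nonempty X := inferInstance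
    obtain ⟨A, B, hAB⟩ := (hX.cut x).exists_separates
    obtain ⟨z, hz⟩ := hAB.nonempty_left
    exact ⟨x, z, fun h => hAB.notMem_left (h ▸ hz)⟩
  have outside : ∀ a b : Y, a ∉ closure (range e)ᶜ →
      ∃ K : Set Y, IsContinuum K ∧ K ≠ univ ∧ a ∈ K ∧ b ∈ K := by
    intro a b ha
    obtain ⟨x, rfl⟩ : a ∈ range e := by
      by_contra h
      exact ha (subset_closure h)
    have side : ∀ A B : Set X, Separates x A B →
        b ∈ closure (e '' insert x A) ∪ closure (range e)ᶜ →
        ∃ K : Set Y, IsContinuum K ∧ K ≠ univ ∧ e x ∈ K ∧ b ∈ K := by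
      intro A B hAB hb
      refine ⟨closure (e '' insert x A) ∪ closure (range e)ᶜ, IsContinuum.of_set
        (isClosed_closure.union isClosed_closure).isCompact ?_, ?_,
        Or.inl (subset_closure ⟨x, mem_insert _ _, rfl⟩), hb⟩
      · obtain ⟨z, hz, hzX⟩ := closure_image_inter_compl_range_nonempty he hAB.isClosed_insert
          (hAB.not_isCompact hX.cut)
        refine IsConnected.union ⟨z, hz, subset_closure hzX⟩ (IsConnected.closure ?_) hconn.closure
        exact IsConnected.image ⟨⟨x, mem_insert _ _⟩, hAB.isPreconnected_insert⟩ e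
          he.continuous.continuousOn
      -- The union is proper: x is in the closure of B, so B has points near x that are off the
      -- closure of the remainder.
      · have hopen : IsOpen (e ⁻¹' (closure (range e)ᶜ)ᶜ) :=
          isClosed_closure.isOpen_compl.preimage he.continuous
        obtain ⟨z, hz, hzB⟩ := mem_closure_iff.1 hAB.symm.mem_closure _ hopen ha
        intro huniv
        rcases huniv.ge (mem_univ (e z)) with h | h
        · have hzA : z ∈ closure (insert x A) := by
            rw [he.isEmbedding.closure_eq_preimage_closure_image]
            exact h
          rw [hAB.isClosed_insert.closure_eq, ← hAB.symm.compl_left] at hzA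
          exact hzA hzB
        · exact hz h
    obtain ⟨A, B, hAB⟩ := (hX.cut x).exists_separates
    by_cases hb : b ∈ range e
    · obtain ⟨z, rfl⟩ := hb
      rcases hAB.mem_cases z with rfl | hz | hz
      · exact side A B hAB (Or.inl (subset_closure ⟨_, mem_insert _ _, rfl⟩))
      · exact side A B hAB (Or.inl (subset_closure ⟨_, Or.inr hz, rfl⟩))
      · exact side B A hAB.symm (Or.inl (subset_closure ⟨_, Or.inr hz, rfl⟩))
    · exact side A B hAB (Or.inr (subset_closure hb))
  intro a b
  by_cases ha : a ∈ closure (range e)ᶜ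
  · by_cases hb : b ∈ closure (range e)ᶜ
    · obtain ⟨γ, hγ⟩ := hpath a ha
      obtain ⟨δ, hδ⟩ := hpath b hb
      refine ⟨range γ ∪ range δ, IsContinuum.of_set
        ((isCompact_range γ.continuous).union (isCompact_range δ.continuous)) ?_, ?_,
        Or.inl ⟨1, γ.target⟩, Or.inr ⟨1, δ.target⟩⟩
      · exact IsConnected.union ⟨o, ⟨0, γ.source⟩, ⟨0, δ.source⟩⟩
          (isConnected_range γ.continuous) (isConnected_range δ.continuous)
      -- The paths meet X at most in a and b, whereas X is infinite, being connected, T1 and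
      -- nontrivial.
      · intro huniv
        have hfin : (univ : Set X).Finite := by
          refine Finite.of_finite_image (f := e) ((Set.toFinite {a, b}).subset ?_) he.injective.injOn
          rintro _ ⟨x, -, rfl⟩
          rcases huniv.ge (mem_univ (e x)) with ⟨t, ht⟩ | ⟨t, ht⟩
          · exact Or.inl (ht ▸ hγ t (ht ▸ mem_range_self x))
          · exact Or.inr (ht ▸ hδ t (ht ▸ mem_range_self x))
        have : Finite X := Set.finite_univ_iff.1 hfin
        obtain ⟨x⟩ : Nonempty X := inferInstance
        have := IsClopen.eq_univ (s := {x}) ⟨isClosed_singleton, isOpen_discrete _⟩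
          (singleton_nonempty x)
        obtain ⟨y, hy⟩ := exists_ne x
        exact hy (this.ge (mem_univ y))
    · obtain ⟨K, h1, h2, h3, h4⟩ := outside b a hb
      exact ⟨K, h1, h2, h4, h3⟩
  · exact outside a b ha

end Compactification

open Filter Topology

/-! ### Locally finite sets of points and bump functions. -/

section Selection

variable {X : Type*}

/-- The points without compact neighbourhoods. -/
def nonLocallyCompactPoints (X : Type*) [TopologicalSpace X] : Set X :=
  {x | ∀ C ∈ 𝓝 x, ¬ IsCompact C}

/-- Each point has a neighbourhood that meets `F` in a finite set. -/
def IsLocallyFinite [TopologicalSpace X] (F : Set X) : Prop :=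
  ∀ x, ∃ W ∈ 𝓝 x, (F ∩ W).Finite

theorem IsLocallyFinite.union [TopologicalSpace X] {F G : Set X} (hF : IsLocallyFinite F)
    (hG : IsLocallyFinite G) : IsLocallyFinite (F ∪ G) := fun x => by
  obtain ⟨W, hW, hfin⟩ := hF x
  obtain ⟨W', hW', hfin'⟩ := hG x
  refine ⟨W ∩ W', inter_mem hW hW', (hfin.union hfin').subset ?_⟩
  rintro z ⟨hz | hz, hzW, hzW'⟩
  · exact Or.inl ⟨hz, hzW⟩
  · exact Or.inr ⟨hz, hzW'⟩

theorem IsLocallyFinite.isClosed [TopologicalSpace X] [T1Space X] {F : Set X}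
    (hF : IsLocallyFinite F) : IsClosed F := by
  refine isClosed_of_closure_subset fun x hx => ?_
  obtain ⟨W, hW, hfin⟩ := hF x
  have : x ∈ closure (F ∩ W) := by
    rw [mem_closure_iff_nhds] at hx ⊢
    intro U hU
    obtain ⟨z, hz, hzF⟩ := hx (U ∩ W) (inter_mem hU hW)
    exact ⟨z, hz.1, hzF, hz.2⟩
  rw [hfin.isClosed.closure_eq] at this
  exact this.1

/-- Without isolated points every neighbourhood is infinite, so none can lie in F. -/
theorem IsLocallyFinite.dense_compl [TopologicalSpace X] [T1Space X]
    [hp : ∀ x : X, (𝓝[≠] x).NeBot] {F : Set X} (hF : IsLocallyFinite F) : Dense Fᶜ := by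
  intro x
  rw [mem_closure_iff_nhds]
  intro U hU
  by_contra hemp
  have hUF : U ⊆ F := fun z hz => by
    by_contra h
    exact hemp ⟨z, hz, h⟩
  obtain ⟨W, hW, hfin⟩ := hF x
  have hinf : (U ∩ W).Infinite := infinite_of_mem_nhds x (inter_mem hU hW)
  exact hinf (hfin.subset (inter_subset_inter_left _ hUF))

theorem isLocallyFinite_range [TopologicalSpace X] {ι : Type*} {a : ι → X}
    (ha : LocallyFinite fun i => ({a i} : Set X)) : IsLocallyFinite (range a) := fun x => by
  obtain ⟨W, hW, hfin⟩ := ha x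
  refine ⟨W, hW, (hfin.image a).subset ?_⟩
  rintro _ ⟨⟨i, rfl⟩, hi⟩
  exact ⟨i, ⟨a i, rfl, hi⟩, rfl⟩

/-- Every neighbourhood of a point without compact neighbourhoods contains an infinite closed
discrete set that avoids a given closed nowhere dense set. -/
theorem exists_infinite_isLocallyFinite [MetricSpace X] {w : X}
    (hw : w ∈ nonLocallyCompactPoints X) {V F : Set X} (hV : IsOpen V) (hwV : w ∈ V)
    (hF : Dense Fᶜ) : ∃ T ⊆ V \ F, T.Infinite ∧ IsLocallyFinite T := by
  obtain ⟨b, hb, hcl⟩ : ∃ b : ℕ → X, (∀ n, b n ∈ V \ F) ∧ ∀ x, ¬ MapClusterPt x atTop b := by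
    by_contra! hall
    -- If every sequence in V \ F clustered, the closure of V \ F would be a compact neighbourhood
    -- of w: sequences in it are shadowed by sequences in V \ F, and it contains V because F has
    -- dense complement.
    refine hw (closure (V \ F)) ?_ ?_
    · refine mem_of_superset (hV.mem_nhds hwV) ?_
      exact (hF.open_subset_closure_inter hV)
    · rw [isCompact_iff_isSeqCompact]
      intro s hs
      have : ∀ n : ℕ, ∃ t ∈ V \ F, dist (s n) t < 1 / (n + 1) := fun n =>
        Metric.mem_closure_iff.1 (hs n) _ Nat.one_div_pos_of_nat
      choose t ht hst using this
      obtain ⟨x, hx⟩ := hall t ht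
      obtain ⟨φ, hφ, hlim⟩ := hx.tendsto_subseq
      refine ⟨x, ?_, φ, hφ, ?_⟩
      · exact mem_closure_of_tendsto hlim (Eventually.of_forall fun n => ht _)
      · refine hlim.congr_dist ?_
        refine squeeze_zero (fun _ => dist_nonneg) (fun n => ?_)
          (tendsto_one_div_add_atTop_nhds_zero_nat.comp hφ.tendsto_atTop)
        rw [dist_comm]
        exact (hst (φ n)).le
  have hloc : LocallyFinite fun n => ({b n} : Set X) := by
    intro x
    have := hcl x
    rw [mapClusterPt_iff_frequently] at this
    push Not at this
    obtain ⟨W, hW, hev⟩ := this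
    refine ⟨W, hW, ?_⟩
    rw [← Nat.cofinite_eq_atTop] at hev
    refine Finite.subset (eventually_cofinite.1 hev) ?_
    rintro n ⟨z, rfl, hz⟩
    exact fun h => h hz
  refine ⟨range b, range_subset_iff.2 hb, fun hfin => ?_, isLocallyFinite_range hloc⟩
  have := hloc.finite_nonempty_inter_compact hfin.isCompact
  refine infinite_univ (this.subset fun n _ => ?_)
  exact ⟨b n, rfl, n, rfl⟩

/-- Infinite sets admit an injective choice function. -/
theorem exists_injective_mem {ι : Type*} [Countable ι] {T : ι → Set X}
    (hT : ∀ i, (T i).Infinite) : ∃ a : ι → X, Function.Injective a ∧ ∀ i, a i ∈ T i := by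
  classical
  obtain ⟨enc, henc⟩ := exists_injective_nat ι
  -- These sizes give Hall's condition: a finite set of indices with largest code k has at most k +
  -- 1 elements, and the set attached to code k has exactly k + 1.
  choose t ht hcard using fun i => (hT i).exists_subset_card_eq (enc i + 1)
  obtain ⟨a, ha, hat⟩ := (Finset.all_card_le_biUnion_card_iff_exists_injective t).1 (by
    intro s
    rcases s.eq_empty_or_nonempty with rfl | hs
    · simp
    obtain ⟨i, hi, hmax⟩ := s.exists_max_image enc hs
    calc s.card = (s.image enc).card := (Finset.card_image_of_injective s henc).symm
      _ ≤ (Finset.range (enc i + 1)).card := Finset.card_le_card (by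
          intro k hk
          obtain ⟨j, hj, rfl⟩ := Finset.mem_image.1 hk
          exact Finset.mem_range.2 (Nat.lt_succ_of_le (hmax j hj)))
      _ = (t i).card := by rw [Finset.card_range, hcard]
      _ ≤ _ := Finset.card_le_card (Finset.subset_biUnion_of_mem t hi))
  exact ⟨a, ha, fun i => ht i (hat i)⟩

/-- Simultaneous selection of infinite closed discrete sets in a locally finite family of open
sets. -/
theorem exists_locallyFinite_points [MetricSpace X] {J : Type*} [Countable J] {V : J → Set X}
    (hV : ∀ j, IsOpen (V j)) (hloc : LocallyFinite V)
    (hN : ∀ j, (V j ∩ nonLocallyCompactPoints X).Nonempty) {F : Set X} (hF : Dense Fᶜ) :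
    ∃ a : J × ℕ → X, Function.Injective a ∧ (LocallyFinite fun i => ({a i} : Set X)) ∧
      ∀ i, a i ∈ V i.1 \ F := by
  have : ∀ j, ∃ T ⊆ V j \ F, T.Infinite ∧ IsLocallyFinite T := fun j => by
    obtain ⟨w, hwV, hw⟩ := hN j
    exact exists_infinite_isLocallyFinite hw (hV j) hwV hF
  choose T hTV hinf hT using this
  obtain ⟨a, ha, haT⟩ := exists_injective_mem (T := fun i : J × ℕ => T i.1) fun i => hinf i.1
  refine ⟨a, ha, fun x => ?_, fun i => hTV _ (haT i)⟩
  obtain ⟨W, hW, hfin⟩ := hloc x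
  choose W' hW' hfin' using fun j => hT j x
  refine ⟨W ∩ ⋂ j ∈ {j | (V j ∩ W).Nonempty}, W' j, inter_mem hW
    ((biInter_mem hfin).2 fun j _ => hW' j), ?_⟩
  refine Finite.subset ((hfin.biUnion fun j _ => hfin' j).preimage ha.injOn) ?_
  rintro i ⟨z, rfl, hzW, hz⟩
  have hj : (V i.1 ∩ W).Nonempty := ⟨a i, (hTV _ (haT i)).1, hzW⟩
  exact mem_biUnion (x := i.1) hj ⟨haT i, mem_iInter₂.1 hz i.1 hj⟩

/-- Locally finite families of points have bump functions with locally finite disjoint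
supports. -/
theorem exists_bumps [MetricSpace X] {ι : Type*} [Countable ι] {a : ι → X}
    (hinj : Function.Injective a) (hloc : LocallyFinite fun i => ({a i} : Set X))
    {W : ι → Set X} (hW : ∀ i, W i ∈ 𝓝 (a i)) :
    ∃ u : ι → X → ℝ, (∀ i, Continuous (u i)) ∧ (LocallyFinite fun i => Function.support (u i)) ∧
      (∀ i x, u i x ∈ Icc (0 : ℝ) 1) ∧ (∀ i, u i (a i) = 1) ∧
      (∀ i, Function.support (u i) ⊆ W i) ∧
      ∀ i j x, u i x ≠ 0 → u j x ≠ 0 → i = j := by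
  obtain ⟨enc, henc⟩ := exists_injective_nat ι
  have hiso : ∀ i, ∃ r > 0, Metric.ball (a i) r ⊆ W i ∧
      (∀ j, j ≠ i → r ≤ dist (a j) (a i)) ∧ r ≤ 1 / ((enc i : ℝ) + 1) := by
    intro i
    have hcl : IsClosed (⋃ j : {j // j ≠ i}, ({a j} : Set X)) :=
      (hloc.comp_injective Subtype.val_injective).isClosed_iUnion fun _ => isClosed_singleton
    have hmem : (⋃ j : {j // j ≠ i}, ({a j} : Set X))ᶜ ∈ 𝓝 (a i) := by
      refine hcl.isOpen_compl.mem_nhds ?_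
      simp only [mem_compl_iff, mem_iUnion, mem_singleton_iff, not_exists]
      rintro ⟨j, hj⟩ h
      exact hj (hinj h).symm
    obtain ⟨r, hr, hsub⟩ := Metric.mem_nhds_iff.1 (inter_mem (hW i) hmem)
    refine ⟨min r (1 / ((enc i : ℝ) + 1)), lt_min hr Nat.one_div_pos_of_nat, ?_, ?_,
      min_le_right _ _⟩
    · exact fun z hz => (hsub (Metric.ball_subset_ball (min_le_left _ _) hz)).1
    · intro j hj
      by_contra! hlt
      have := (hsub (Metric.mem_ball.2 (hlt.trans_le (min_le_left _ _)))).2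
      exact this (mem_iUnion.2 ⟨⟨j, hj⟩, rfl⟩)
  choose r hr hrW hrd hre using hiso
  have hsupp : ∀ i x, max 0 (1 - dist x (a i) / (r i / 2)) ≠ 0 → dist x (a i) < r i / 2 := by
    intro i x hx
    by_contra! hle
    refine hx (max_eq_left ?_)
    rw [sub_nonpos, one_le_div (half_pos (hr i))]
    exact hle
  refine ⟨fun i x => max 0 (1 - dist x (a i) / (r i / 2)), fun i => by fun_prop, fun x => ?_,
    fun i x => ⟨le_max_left _ _, max_le zero_le_one (sub_le_self _ ?_)⟩, fun i => by simp,
    fun i x hx => hrW i (Metric.mem_ball.2 ((hsupp i x hx).trans (half_lt_self (hr i)))), ?_⟩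
  · obtain ⟨U, hU, hfin⟩ := hloc x
    obtain ⟨δ, hδ, hsub⟩ := Metric.mem_nhds_iff.1 hU
    -- Bumps of code above n have radius below δ / 2, so one that meets the ball has its centre in
    -- U; only finitely many codes remain.
    obtain ⟨n, hn⟩ := exists_nat_one_div_lt (half_pos hδ)
    refine ⟨Metric.ball x (δ / 2), Metric.ball_mem_nhds _ (half_pos hδ), ?_⟩
    refine (hfin.union ((Set.finite_lt_nat (n + 1)).preimage henc.injOn)).subset ?_
    rintro i ⟨z, hz, hzx⟩
    by_cases hi : enc i < n + 1
    · exact Or.inr hi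
    · refine Or.inl ⟨a i, rfl, hsub (Metric.mem_ball.2 ?_)⟩
      have h1 := hsupp i z hz
      have h2 : (1 : ℝ) / ((enc i : ℝ) + 1) ≤ 1 / (n + 1) := by
        refine one_div_le_one_div_of_le (by positivity) ?_
        have : n ≤ enc i := by omega
        have : (n : ℝ) ≤ enc i := by exact_mod_cast this
        linarith
      have h3 := hre i
      have h4 := dist_triangle_left (a i) x z
      have h5 := hr i
      rw [Metric.mem_ball] at hzx
      linarith
  · exact div_nonneg dist_nonneg (half_pos (hr i)).le
  · intro i j x hi hj
    by_contra hij
    have h1 := hsupp i x hi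
    have h2 := hsupp j x hj
    have h3 := dist_triangle_left (a i) (a j) x
    have h4 := hrd j i hij
    have h5 := hrd i j (Ne.symm hij)
    rw [dist_comm] at h5
    linarith

/-- A continuous map can be moved by bumps to prescribed values at the points of a locally finite
family. -/
theorem exists_bump_modification [TopologicalSpace X] {ι E : Type*} [AddCommGroup E] [Module ℝ E]
    [TopologicalSpace E] [IsTopologicalAddGroup E] [ContinuousSMul ℝ E] {u : ι → X → ℝ}
    (hu : ∀ i, Continuous (u i)) (hloc : LocallyFinite fun i => Function.support (u i))
    (hdis : ∀ i j x, u i x ≠ 0 → u j x ≠ 0 → i = j) {c : X → E} (hc : Continuous c) (v : ι → E) :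
    ∃ f : X → E, Continuous f ∧ (∀ i x, u i x ≠ 0 → f x = (1 - u i x) • c x + u i x • v i) ∧
      ∀ x, (∀ i, u i x = 0) → f x = c x := by
  refine ⟨fun x => c x + ∑ᶠ i, u i x • (v i - c x), hc.add (continuous_finsum (fun i => ?_) ?_),
    fun i x hi => ?_, fun x hx => ?_⟩
  · exact (hu i).smul (continuous_const.sub hc)
  · exact hloc.subset fun i x hx => left_ne_zero_of_smul hx
  · have : ∑ᶠ j, u j x • (v j - c x) = u i x • (v i - c x) := by
      refine finsum_eq_single _ i fun j hj => ?_
      have : u j x = 0 := by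
        by_contra h
        exact hj (hdis j i x h hi)
      rw [this, zero_smul]
    simp only [this]
    module
  · simp [hx]

end Selection

/-! ### Adding one coordinate. -/

section Stages

/-- A finite stage in the construction of the coordinate functions: the first `m` coordinates of
`toFun` are meaningful, `fixed` is the set of points whose coordinates are final, `scale` bounds
the size of further coordinates there, and `constraint` is an open condition that all further
stages have to respect. -/
structure Stage (X : Type*) [TopologicalSpace X] (m : ℕ) where
  toFun : X → ℕ → ℝ
  continuous_toFun : Continuous toFun
  fixed : Set X
  isLocallyFinite_fixed : IsLocallyFinite fixed
  scale : X → ℝ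
  continuous_scale : Continuous scale
  scale_pos : ∀ x, 0 < scale x
  scale_le : ∀ x, scale x ≤ 1
  constraint : Set (X × (ℕ → ℝ))
  isOpen_constraint : IsOpen constraint
  constraint_congr : ∀ x p q, (∀ i < m, p i = q i) → (x, p) ∈ constraint → (x, q) ∈ constraint
  graph_mem : ∀ x, (x, toFun x) ∈ constraint

/-- The stage `s'` adds to the stage `s` a coordinate that is positive on `K` and negative off
`U`. -/
structure Stage.Extends {X : Type*} [TopologicalSpace X] {m : ℕ} (s : Stage X m)
    (s' : Stage X (m + 1)) (K U : Set X) : Prop where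
  abs_sub_le : ∀ x, ∀ i < m, |s'.toFun x i - s.toFun x i| ≤ (1 / 2) ^ m
  eq_of_mem : ∀ x ∈ s.fixed, ∀ i < m, s'.toFun x i = s.toFun x i
  abs_le_scale : ∀ x ∈ s.fixed, |s'.toFun x m| ≤ s.scale x
  fixed_subset : s.fixed ⊆ s'.fixed
  scale_le : ∀ x, s'.scale x ≤ s.scale x
  constraint_subset : s'.constraint ⊆ s.constraint
  neg_of_notMem : ∀ x p, (x, p) ∈ s'.constraint → x ∉ U → p m < 0
  pos_of_mem : ∀ x ∈ K, 0 < s'.toFun x m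
  -- The factor one half leaves a lower bound that survives passage to the limit of the stages.
  lt_of_mem : ∀ x p, (x, p) ∈ s'.constraint → x ∈ K → s'.toFun x m / 2 < p m
  -- Source of the truncation property. It speaks of all p in the constraint, so it also applies to
  -- the values of later stages.
  approx : ∀ x p, (x, p) ∈ s'.constraint → 0 ≤ p m → ∀ t ∈ Icc (0 : ℝ) 1, ∀ ε > 0,
    ∃ b : ℕ → X, (LocallyFinite fun n => ({b n} : Set X)) ∧ (∀ n, b n ∈ s'.fixed) ∧
      Tendsto (fun n => s'.scale (b n)) atTop (𝓝 0) ∧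
      ∀ n, (∀ i < m, |s'.toFun (b n) i - p i| < ε) ∧ |s'.toFun (b n) m - t| < ε

/-- The box of radius `r` around `h` in the first `m` coordinates. -/
def box (m : ℕ) (h : ℕ → ℝ) (r : ℝ) : Set (ℕ → ℝ) := {p | ∀ i < m, |p i - h i| < r}

theorem isOpen_box (m : ℕ) (h : ℕ → ℝ) (r : ℝ) : IsOpen (box m h r) := by
  have : box m h r = ⋂ i ∈ Iio m, {p | |p i - h i| < r} := by
    ext p; simp [box]
  rw [this]
  refine (finite_Iio m).isOpen_biInter fun i _ => isOpen_lt (by fun_prop) continuous_const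

theorem box_combination {m : ℕ} {h p q : ℕ → ℝ} {r s : ℝ} (hs : s ∈ Icc (0 : ℝ) 1)
    (hp : p ∈ box m h r) (hq : q ∈ box m h r) : (1 - s) • p + s • q ∈ box m h r := by
  intro i hi
  have h1 := abs_lt.1 (hp i hi)
  have h2 := abs_lt.1 (hq i hi)
  simp only [Pi.add_apply, Pi.smul_apply, smul_eq_mul]
  have hs0 := hs.1
  have hs1 : 0 ≤ 1 - s := sub_nonneg.2 hs.2
  have key : (1 - s) * p i + s * q i - h i = (1 - s) * (p i - h i) + s * (q i - h i) := by ring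
  have hc : Convex ℝ (Ioo (-r) r) := convex_Ioo _ _
  rw [key, abs_lt]
  have := hc (mem_Ioo.2 h1) (mem_Ioo.2 h2) hs1 hs0 (by ring)
  exact this

/-- An open condition on the first `m` coordinates that holds at a point holds on a cell around
it. -/
theorem Stage.exists_cell {X : Type*} [TopologicalSpace X] {m : ℕ} (s : Stage X m) {U : Set X}
    (hU : IsOpen U) {w : X} (hw : w ∈ U) {ε : ℝ} (hε : 0 < ε) :
    ∃ O : Set X, ∃ r : ℝ, IsOpen O ∧ w ∈ O ∧ 0 < r ∧ r ≤ ε ∧ O ⊆ U ∧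
      (∀ x ∈ O, s.toFun x ∈ box m (s.toFun w) r) ∧
      ∀ x ∈ O, ∀ p ∈ box m (s.toFun w) r, (x, p) ∈ s.constraint := by
  have hmem := s.isOpen_constraint.mem_nhds (s.graph_mem w)
  rw [nhds_prod_eq, Filter.mem_prod_iff] at hmem
  obtain ⟨A, hA, B, hB, hAB⟩ := hmem
  obtain ⟨r, hr, hrε, hrB⟩ : ∃ r > 0, r ≤ ε ∧
      ∀ p : ℕ → ℝ, (∀ i, |p i - s.toFun w i| < r) → p ∈ B := by
    rw [nhds_pi, Filter.mem_pi] at hB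
    obtain ⟨I, hI, t, ht, htB⟩ := hB
    have : ∀ i, ∃ r > 0, Metric.ball (s.toFun w i) r ⊆ t i := fun i =>
      Metric.mem_nhds_iff.1 (ht i)
    choose r hr hrt using this
    obtain ⟨ρ, hρ, hρI⟩ : ∃ ρ > 0, ∀ i ∈ I, ρ ≤ r i := by
      have := (hI.eventually_all (l := 𝓝[>] (0 : ℝ)) (p := fun i ρ => ρ ≤ r i)).2 fun i _ =>
        mem_nhdsWithin_of_mem_nhds (Iic_mem_nhds (hr i))
      obtain ⟨ρ, h1, h2⟩ := (this.and self_mem_nhdsWithin).exists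
      exact ⟨ρ, h2, h1⟩
    refine ⟨min ρ ε, lt_min hρ hε, min_le_right _ _, fun p hp => htB fun i hi => hrt i ?_⟩
    rw [Metric.mem_ball, Real.dist_eq]
    exact (hp i).trans_le ((min_le_left _ _).trans (hρI i hi))
  refine ⟨interior A ∩ U ∩ s.toFun ⁻¹' box m (s.toFun w) r, r,
    (isOpen_interior.inter hU).inter ((isOpen_box _ _ _).preimage s.continuous_toFun),
    ⟨⟨mem_interior_iff_mem_nhds.2 hA, hw⟩, fun i _ => by simpa using hr⟩, hr, hrε,
    fun x hx => hx.1.2, fun x hx => hx.2, fun x hx p hp => ?_⟩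
  -- Coordinates from m on are irrelevant to the constraint and are reset to those of w, so that all
  -- of them are within r.
  refine s.constraint_congr x (fun i => if i < m then p i else s.toFun w i) p
    (fun i hi => if_pos hi) (hAB ⟨interior_subset hx.1.1, hrB _ fun i => ?_⟩)
  by_cases hi : i < m
  · simpa [hi] using hp i hi
  · simpa [hi] using hr

/-- A sequence in the open infinite-dimensional cube with all tails dense. -/
noncomputable def cubeSeq (n : ℕ) : ℕ → Ioo (0 : ℝ) 1 :=
  haveI : Nonempty (Ioo (0 : ℝ) 1) := ⟨⟨1 / 2, by norm_num⟩⟩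
  denseSeq (ℕ → Ioo (0 : ℝ) 1) n.unpair.1

/-- The term of the dense sequence with index k recurs at every `k.pair n`, so a single k serves
infinitely many indices. -/
theorem exists_cubeSeq_approx (m : ℕ) {p : ℕ → ℝ} (hp : ∀ i < m, p i ∈ Ioo (0 : ℝ) 1)
    {t : ℝ} (ht : t ∈ Icc (0 : ℝ) 1) {ε : ℝ} (hε : 0 < ε) :
    ∃ k : ℕ, ∀ n, (∀ i < m, |(cubeSeq (k.pair n) i : ℝ) - p i| < ε) ∧
      |(cubeSeq (k.pair n) m : ℝ) - t| < ε := by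
  have : Nonempty (Ioo (0 : ℝ) 1) := ⟨⟨1 / 2, by norm_num⟩⟩
  let G : Set (ℕ → Ioo (0 : ℝ) 1) :=
    (⋂ i ∈ Iio m, {θ | |(θ i : ℝ) - p i| < ε}) ∩ {θ | |(θ m : ℝ) - t| < ε}
  have hG : IsOpen G := by
    refine IsOpen.inter ((finite_Iio m).isOpen_biInter fun i _ => ?_) ?_
    · exact isOpen_lt (by fun_prop) continuous_const
    · exact isOpen_lt (by fun_prop) continuous_const
  have hne : G.Nonempty := by
    have hδ : 0 < min ε 1 := lt_min hε one_pos
    have hδ1 : min ε 1 ≤ 1 := min_le_right _ _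
    have hδε : min ε 1 ≤ ε := min_le_left _ _
    set δ := min ε 1
    -- The number t may be an end of the interval; it is moved by at most δ / 2 towards the
    -- midpoint.
    have ht' : (1 - δ) * t + δ / 2 ∈ Ioo (0 : ℝ) 1 := by
      constructor <;> nlinarith [ht.1, ht.2]
    refine ⟨fun i => if hi : i < m then ⟨p i, hp i hi⟩ else ⟨_, ht'⟩, ?_, ?_⟩
    · refine mem_iInter₂.2 fun i hi => ?_
      have hi' : i < m := hi
      simpa [hi'] using hε
    · simp only [mem_ofPred_eq, lt_irrefl, dite_false, abs_lt]
      constructor <;> nlinarith [ht.1, ht.2]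
  obtain ⟨k, hk⟩ := (denseRange_denseSeq (ℕ → Ioo (0 : ℝ) 1)).exists_mem_open hG hne
  refine ⟨k, fun n => ?_⟩
  have : cubeSeq (k.pair n) = denseSeq (ℕ → Ioo (0 : ℝ) 1) k := by simp [cubeSeq]
  rw [this]
  exact ⟨fun i hi => mem_iInter₂.1 hk.1 i hi, hk.2⟩

/-- K is covered by a locally finite family of cells on which any values in a box respect the old
constraint. Each cell receives infinitely many new fixed points, whose values run through a dense
subset of the box times the unit interval. -/
theorem Stage.exists_extends {X : Type*} [MetricSpace X] [SeparableSpace X]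
    [∀ x : X, (𝓝[≠] x).NeBot] {m : ℕ} (s : Stage X m) {K U : Set X} (hK : IsClosed K)
    (hKN : K ⊆ nonLocallyCompactPoints X) (hU : IsOpen U) (hKU : K ⊆ U) :
    ∃ s' : Stage X (m + 1), s.Extends s' K U := by
  have hε : (0 : ℝ) < (1 / 2) ^ (m + 1) := by positivity
  have hcell : ∀ w : K, _ := fun w => s.exists_cell hU (hKU w.2) hε
  choose O r hO hwO hr hrε hOU hOH hOc using hcell
  obtain ⟨f, hf⟩ := PartitionOfUnity.exists_isSubordinate hK O hO
    fun x hx => mem_iUnion.2 ⟨⟨x, hx⟩, hwO _⟩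
  -- Only cells that meet K are kept, so that each contains a point without compact neighbourhoods.
  let J : Type _ := {w : K // ∃ x ∈ K, f w x ≠ 0}
  let V : J → Set X := fun j => Function.support (f j.1)
  have hVO : ∀ j, V j ⊆ O j.1 := fun j => (subset_tsupport _).trans (hf j.1)
  have hVopen : ∀ j, IsOpen (V j) := fun j =>
    isOpen_ne_fun (f j.1).continuous continuous_const
  have hVloc : LocallyFinite V := f.locallyFinite.comp_injective Subtype.val_injective
  have : Countable J := by
    obtain ⟨D, hD, hDd⟩ := exists_countable_dense X
    rw [← Set.countable_univ_iff]
    refine (hD.biUnion fun x _ => (hVloc.point_finite x).countable).mono fun j _ => ?_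
    obtain ⟨x, hxD, hx⟩ := hDd.exists_mem_open (hVopen j) (j.2.imp fun x hx => hx.2)
    exact mem_biUnion hxD hx
  have hKV : K ⊆ ⋃ j, V j := by
    intro x hx
    obtain ⟨w, hw⟩ := f.exists_pos hx
    exact mem_iUnion.2 ⟨⟨w, x, hx, hw.ne'⟩, hw.ne'⟩
  obtain ⟨a, hainj, haloc, haV⟩ := exists_locallyFinite_points hVopen hVloc
    (fun j => j.2.imp fun x hx => ⟨hx.2, hKN hx.1⟩) s.isLocallyFinite_fixed.dense_compl
  obtain ⟨u, hu, huloc, hu01, hua, hus, hudis⟩ := exists_bumps hainj haloc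
    (W := fun i => V i.1 \ s.fixed) fun i =>
      ((hVopen i.1).sdiff s.isLocallyFinite_fixed.isClosed).mem_nhds (haV i)
  obtain ⟨g, hg0, hg1, hg01⟩ := exists_continuous_zero_one_of_isClosed
    (isOpen_iUnion hVopen).isClosed_compl hK (disjoint_compl_left_iff_subset.2 hKV)
  -- Values before the bumps: the new coordinate is `s.scale` on K and its negative off the cells,
  -- never larger in modulus.
  let c : X → ℕ → ℝ := fun x i =>
    if i < m then s.toFun x i else if i = m then s.scale x * (2 * g x - 1) else 0
  have hc : Continuous c := by
    refine continuous_pi fun i => ?_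
    have := (continuous_apply i).comp s.continuous_toFun
    have := s.continuous_scale
    by_cases hi : i < m
    · simpa [c, hi]
    · by_cases hi' : i = m
      · simp only [c, hi', if_true, if_false, lt_irrefl]
        fun_prop
      · simpa [c, hi, hi'] using continuous_const
  -- The open cube is rescaled to the box of the cell; the coordinate m stays positive.
  let v : J × ℕ → ℕ → ℝ := fun k i =>
    if i < m then s.toFun k.1.1 i + r k.1.1 * (2 * cubeSeq k.2 i - 1)
    else if i = m then cubeSeq k.2 m else 0
  obtain ⟨H, hH, hHu, hHc⟩ := exists_bump_modification hu huloc hudis hc v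
  obtain ⟨ρ, hρ, hρu, hρc⟩ := exists_bump_modification hu huloc hudis
    (continuous_const (y := (1 : ℝ))) fun k => 1 / ((k.2 : ℝ) + 1)
  have hcm : ∀ x, c x m = s.scale x * (2 * g x - 1) := fun x => by simp [c]
  have hcbox : ∀ j, ∀ x ∈ V j, c x ∈ box m (s.toFun j.1) (r j.1) := by
    intro j x hx i hi
    simpa [c, hi] using hOH j.1 x (hVO j hx) i hi
  have hvbox : ∀ k : J × ℕ, v k ∈ box m (s.toFun k.1.1) (r k.1.1) := by
    intro k i hi
    have h1 := (cubeSeq k.2 i).2.1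
    have h2 := (cubeSeq k.2 i).2.2
    have h3 := hr k.1.1
    simp only [v, hi, if_true, add_sub_cancel_left, abs_lt]
    constructor <;> nlinarith
  have hvm : ∀ k : J × ℕ, 0 < v k m := fun k => by
    simpa [v] using (cubeSeq k.2 m).2.1
  have hcases : ∀ x, H x = c x ∨ ∃ k, x ∈ V k.1 ∧ x ∉ s.fixed ∧ 0 < u k x ∧
      H x = (1 - u k x) • c x + u k x • v k := by
    intro x
    by_cases hx : ∀ i, u i x = 0
    · exact Or.inl (hHc x hx)
    · push Not at hx
      obtain ⟨k, hk⟩ := hx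
      have := hus k hk
      exact Or.inr ⟨k, this.1, this.2, (hu01 k x).1.lt_of_ne' hk, hHu k x hk⟩
  -- The new constraint puts p in one of the boxes whenever the coordinate m is nonnegative; there
  -- the values v are dense.
  let S : Set (ℕ → ℝ) := ⋃ j : J, box m (s.toFun j.1) (r j.1)
  have hS : IsOpen S := isOpen_iUnion fun j => isOpen_box _ _ _
  have hgraph : ∀ x, (x, H x) ∈ s.constraint ∧ (0 ≤ H x m → H x ∈ S) ∧ (x ∉ U → H x m < 0) ∧
      (x ∈ K → 0 < H x m) := by
    intro x
    rcases hcases x with h | ⟨k, hkV, -, hk0, h⟩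
    · have hneg : x ∉ ⋃ j, V j → H x m < 0 := fun hx => by
        have hg : g x = 0 := hg0 hx
        rw [h, hcm, hg]
        linarith [s.scale_pos x]
      refine ⟨?_, fun h0 => ?_, fun hx => hneg fun hx' => ?_, fun hx => ?_⟩
      · refine s.constraint_congr x (s.toFun x) _ (fun i hi => ?_) (s.graph_mem x)
        rw [h]
        simp [c, hi]
      · have : x ∈ ⋃ j, V j := by
          by_contra hx
          exact absurd h0 (not_le.2 (hneg hx))
        obtain ⟨j, hj⟩ := mem_iUnion.1 this
        exact mem_iUnion.2 ⟨j, h ▸ hcbox j x hj⟩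
      · obtain ⟨j, hj⟩ := mem_iUnion.1 hx'
        exact hx (hOU j.1 (hVO j hj))
      · have hg : g x = 1 := hg1 hx
        rw [h, hcm, hg]
        linarith [s.scale_pos x]
    · have hbox : H x ∈ box m (s.toFun k.1.1) (r k.1.1) := by
        rw [h]
        exact box_combination (hu01 k x) (hcbox _ x hkV) (hvbox k)
      refine ⟨hOc k.1.1 x (hVO _ hkV) _ hbox, fun _ => mem_iUnion.2 ⟨k.1, hbox⟩,
        fun hx => absurd (hOU k.1.1 (hVO _ hkV)) hx, fun hx => ?_⟩
      have hg : g x = 1 := hg1 hx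
      have hc0 : 0 < c x m := by
        rw [hcm, hg]
        linarith [s.scale_pos x]
      rw [h]
      simp only [Pi.add_apply, Pi.smul_apply, smul_eq_mul]
      have h1 := (hu01 k x).2
      exact add_pos_of_nonneg_of_pos (mul_nonneg (sub_nonneg.2 h1) hc0.le)
        (mul_pos hk0 (hvm k))
  have hfixed : ∀ x ∈ s.fixed, H x = c x := fun x hx => by
    rcases hcases x with h | ⟨k, -, hk, -⟩
    · exact h
    · exact absurd hx hk
  have hρ01 : ∀ x, 0 < ρ x ∧ ρ x ≤ 1 := by
    intro x
    by_cases hx : ∀ i, u i x = 0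
    · rw [hρc x hx]
      norm_num
    · push Not at hx
      obtain ⟨k, hk⟩ := hx
      rw [hρu k x hk]
      have h1 := hu01 k x
      have h2 : (0 : ℝ) < 1 / ((k.2 : ℝ) + 1) := Nat.one_div_pos_of_nat
      have h3 : 1 / ((k.2 : ℝ) + 1) ≤ 1 := by
        rw [div_le_one (by positivity)]
        have : (0 : ℝ) ≤ k.2 := Nat.cast_nonneg _
        linarith
      have h4 : 0 < u k x := h1.1.lt_of_ne' hk
      simp only [smul_eq_mul]
      constructor
      · have := mul_pos h4 h2
        linarith [h1.2]
      · nlinarith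
  have hHa : ∀ k, H (a k) = v k := fun k => by
    rw [hHu k (a k) (by rw [hua]; exact one_ne_zero), hua]
    simp
  have hρa : ∀ k, ρ (a k) = 1 / ((k.2 : ℝ) + 1) := fun k => by
    rw [hρu k (a k) (by rw [hua]; exact one_ne_zero), hua]
    simp
  let s' : Stage X (m + 1) :=
    { toFun := H
      continuous_toFun := hH
      fixed := s.fixed ∪ range a
      isLocallyFinite_fixed := s.isLocallyFinite_fixed.union (isLocallyFinite_range haloc)
      scale := fun x => s.scale x * ρ x
      continuous_scale := s.continuous_scale.mul hρ
      scale_pos := fun x => mul_pos (s.scale_pos x) (hρ01 x).1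
      scale_le := fun x => mul_le_one₀ (s.scale_le x) (hρ01 x).1.le (hρ01 x).2
      constraint := s.constraint ∩ {z | 0 ≤ z.2 m → z.2 ∈ S} ∩ {z | z.1 ∉ U → z.2 m < 0} ∩
        {z | z.1 ∈ K → H z.1 m / 2 < z.2 m}
      isOpen_constraint := by
        have hm : Continuous fun z : X × (ℕ → ℝ) => z.2 m := by fun_prop
        refine ((s.isOpen_constraint.inter ?_).inter ?_).inter ?_
        · simp only [imp_iff_not_or, not_le, ofPred_or]
          exact (isOpen_lt hm continuous_const).union (hS.preimage continuous_snd)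
        · simp only [imp_iff_not_or, not_not, ofPred_or]
          exact (hU.preimage continuous_fst).union (isOpen_lt hm continuous_const)
        · simp only [imp_iff_not_or, ofPred_or]
          refine (hK.isOpen_compl.preimage continuous_fst).union (isOpen_lt ?_ hm)
          fun_prop
      constraint_congr := by
        rintro x p q hpq ⟨⟨⟨h1, h2⟩, h3⟩, h4⟩
        have hpm := hpq m m.lt_succ_self
        have hpi : ∀ i < m, p i = q i := fun i hi => hpq i (hi.trans m.lt_succ_self)
        refine ⟨⟨⟨s.constraint_congr x p q hpi h1, fun h => ?_⟩, fun h => ?_⟩, fun h => ?_⟩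
        · obtain ⟨j, hj⟩ := mem_iUnion.1 (h2 (show 0 ≤ p m from hpm ▸ h))
          refine mem_iUnion.2 ⟨j, fun i hi => ?_⟩
          have := hj i hi
          rwa [show (x, p).2 i = q i from hpi i hi] at this
        · exact hpm.symm.trans_lt (h3 h)
        · exact (h4 h).trans_eq hpm
      graph_mem := fun x => by
        obtain ⟨h1, h2, h3, h4⟩ := hgraph x
        exact ⟨⟨⟨h1, h2⟩, h3⟩, fun h => half_lt_self (h4 h)⟩ }
  refine ⟨s', ?_, ?_, ?_, subset_union_left, ?_, ?_, ?_, fun x hx => (hgraph x).2.2.2 hx, ?_, ?_⟩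
  · intro x i hi
    change |H x i - s.toFun x i| ≤ _
    rcases hcases x with h | ⟨k, hkV, -, -, h⟩
    · rw [h]
      simp only [c, hi, if_true, sub_self, abs_zero]
      positivity
    · have hbox : H x ∈ box m (s.toFun k.1.1) (r k.1.1) := by
        rw [h]
        exact box_combination (hu01 k x) (hcbox _ x hkV) (hvbox k)
      -- Old and new values are both within r of the centre of the box, and 2r is at most (1/2)^m.
      have h1 := abs_lt.1 (hbox i hi)
      have h2 := abs_lt.1 (hOH k.1.1 x (hVO _ hkV) i hi)
      have h3 := hrε k.1.1
      rw [pow_succ] at h3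
      rw [abs_le]
      constructor <;> linarith
  · intro x hx i hi
    change H x i = _
    rw [hfixed x hx]
    simp [c, hi]
  · intro x hx
    change |H x m| ≤ _
    rw [hfixed x hx, hcm, abs_mul, abs_of_pos (s.scale_pos x)]
    refine mul_le_of_le_one_right (s.scale_pos x).le ?_
    have := hg01 x
    rw [abs_le]
    constructor <;> linarith [this.1, this.2]
  · exact fun x => mul_le_of_le_one_right (s.scale_pos x).le (hρ01 x).2
  · exact fun z hz => hz.1.1.1
  · exact fun x p h hx => h.1.2 hx
  · exact fun x p h hx => h.2 hx
  · intro x p h hpm t ht ε hε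
    obtain ⟨j, hj⟩ := mem_iUnion.1 (h.1.1.2 hpm)
    have hrj := hr j.1
    obtain ⟨k, hk⟩ := exists_cubeSeq_approx m
      (p := fun i => ((p i - s.toFun j.1 i) / r j.1 + 1) / 2) (fun i hi => by
        have h1 := abs_lt.1 (hj i hi)
        have h2 : -1 < (p i - s.toFun j.1 i) / r j.1 := by
          rw [lt_div_iff₀ hrj]
          linarith [h1.1]
        have h3 : (p i - s.toFun j.1 i) / r j.1 < 1 := by
          rw [div_lt_iff₀ hrj]
          linarith [h1.2]
        constructor <;> linarith) ht (ε := min ε (ε / (2 * r j.1))) (by positivity)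
    have hinj : Function.Injective fun n : ℕ => ((j, k.pair n) : J × ℕ) := by
      intro n n' hnn
      have := congrArg (fun z : J × ℕ => z.2.unpair.2) hnn
      simpa using this
    refine ⟨fun n => a (j, k.pair n), haloc.comp_injective hinj, fun n => Or.inr ⟨_, rfl⟩, ?_, ?_⟩
    · refine squeeze_zero (fun n => (mul_pos (s.scale_pos _) (hρ01 _).1).le) (fun n => ?_)
        tendsto_one_div_add_atTop_nhds_zero_nat
      refine (mul_le_of_le_one_left (hρ01 _).1.le (s.scale_le _)).trans ?_
      rw [hρa]
      refine one_div_le_one_div_of_le (by positivity) ?_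
      have : (n : ℝ) ≤ (k.pair n : ℕ) := by exact_mod_cast Nat.right_le_pair k n
      simpa using this
    · intro n
      change (∀ i < m, |H _ i - p i| < ε) ∧ |H _ m - t| < ε
      rw [hHa]
      constructor
      · intro i hi
        have h1 := ((hk n).1 i hi).trans_le (min_le_right _ _)
        rw [lt_div_iff₀ (by positivity)] at h1
        have h2 : v (j, k.pair n) i - p i = (2 * r j.1) *
            (cubeSeq (k.pair n) i - ((p i - s.toFun j.1 i) / r j.1 + 1) / 2) := by
          simp only [v, hi, if_true]
          field_simp
          ring
        rw [h2, abs_mul, abs_of_pos (by positivity), mul_comm]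
        exact h1
      · simpa [v] using (hk n).2.trans_le (min_le_left _ _)

end Stages

/-! ### The limit of the stages. -/

section Coordinates

/-- The initial stage without coordinates. -/
noncomputable def Stage.initial (X : Type*) [TopologicalSpace X] : Stage X 0 where
  toFun := fun _ _ => 0
  continuous_toFun := continuous_const
  fixed := ∅
  isLocallyFinite_fixed := fun _ => ⟨univ, univ_mem, by simp⟩
  scale := fun _ => 1
  continuous_scale := continuous_const
  scale_pos := fun _ => one_pos
  scale_le := fun _ => le_rfl
  constraint := univ
  isOpen_constraint := isOpen_univ
  constraint_congr := fun _ _ _ _ _ => mem_univ _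
  graph_mem := fun _ => mem_univ _

theorem exists_stages {X : Type*} [MetricSpace X] [SeparableSpace X]
    [∀ x : X, (𝓝[≠] x).NeBot] {K U : ℕ → Set X} (hK : ∀ m, IsClosed (K m))
    (hKN : ∀ m, K m ⊆ nonLocallyCompactPoints X) (hU : ∀ m, IsOpen (U m))
    (hKU : ∀ m, K m ⊆ U m) :
    ∃ s : ∀ m, Stage X m, ∀ m, (s m).Extends (s (m + 1)) (K m) (U m) := by
  choose next hnext using fun (m : ℕ) (s : Stage X m) =>
    s.exists_extends (hK m) (hKN m) (hU m) (hKU m)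
  exact ⟨fun m => Nat.rec (Stage.initial X) next m, fun m => hnext m _⟩

/-- Coordinate functions with the truncation property: the values of the first `m` coordinates
at a point where the coordinate `m` is positive, followed by any number of the unit interval and
by zeros, are approximated along sequences that leave every compact set. -/
theorem exists_coordinates {X : Type*} [MetricSpace X] [SeparableSpace X]
    [∀ x : X, (𝓝[≠] x).NeBot] {K U : ℕ → Set X} (hK : ∀ m, IsClosed (K m))
    (hKN : ∀ m, K m ⊆ nonLocallyCompactPoints X) (hU : ∀ m, IsOpen (U m))
    (hKU : ∀ m, K m ⊆ U m) :
    ∃ h : X → ℕ → ℝ, Continuous h ∧ (∀ m, ∀ x ∈ K m, 0 < h x m) ∧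
      (∀ m, ∀ x ∉ U m, h x m ≤ 0) ∧
      ∀ m x, 0 < h x m → ∀ t ∈ Icc (0 : ℝ) 1, ∀ ε > 0,
        ∃ b : ℕ → X, (LocallyFinite fun n => ({b n} : Set X)) ∧
          (∀ n, (∀ i < m, |h (b n) i - h x i| < ε) ∧ |h (b n) m - t| < ε) ∧
          ∀ i > m, Tendsto (fun n => h (b n) i) atTop (𝓝 0) := by
  obtain ⟨s, hs⟩ := exists_stages hK hKN hU hKU
  have hfixed : ∀ {m n}, m ≤ n → (s m).fixed ⊆ (s n).fixed :=
    fun {m n} hmn => monotone_nat_of_le_succ (f := fun m => (s m).fixed)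
      (fun m => (hs m).fixed_subset) hmn
  have hcon : ∀ {m n}, m ≤ n → (s n).constraint ⊆ (s m).constraint :=
    fun {m n} hmn => antitone_nat_of_succ_le (f := fun m => (s m).constraint)
      (fun m => (hs m).constraint_subset) hmn
  have hscale : ∀ {m n}, m ≤ n → ∀ x, (s n).scale x ≤ (s m).scale x :=
    fun {m n} hmn x => antitone_nat_of_succ_le (f := fun m => (s m).scale x)
      (fun m => (hs m).scale_le x) hmn
  let f : ℕ → ℕ → X → ℝ := fun i n x => (s (i + 1 + n)).toFun x i
  have hstep : ∀ i x n, dist (f i n x) (f i (n + 1) x) ≤ 1 * (1 / 2) ^ n := by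
    intro i x n
    rw [dist_comm, Real.dist_eq, one_mul]
    refine ((hs (i + 1 + n)).abs_sub_le x i (by omega)).trans ?_
    exact pow_le_pow_of_le_one (by norm_num) (by norm_num) (by omega)
  have hlim : ∀ i x, ∃ y, Tendsto (fun n => f i n x) atTop (𝓝 y) := fun i x =>
    cauchySeq_tendsto_of_complete
      (cauchySeq_of_le_geometric (1 / 2) 1 (by norm_num) (hstep i x))
  choose h' hh' using hlim
  let h : X → ℕ → ℝ := fun x i => h' i x
  have hh : ∀ x i, Tendsto (fun n => f i n x) atTop (𝓝 (h x i)) := fun x i => hh' i x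
  have htail : ∀ x i, Tendsto (fun n => (s n).toFun x i) atTop (𝓝 (h x i)) := fun x i => by
    rw [← tendsto_add_atTop_iff_nat (i + 1)]
    refine (hh x i).congr fun n => ?_
    exact congrArg (fun k => (s k).toFun x i) (add_comm (i + 1) n)
  have hcont : Continuous h := by
    refine continuous_pi fun i => ?_
    have hu : TendstoUniformly (f i) (fun x => h x i) atTop := by
      rw [Metric.tendstoUniformly_iff]
      intro ε hε
      have : Tendsto (fun n : ℕ => 1 * (1 / 2 : ℝ) ^ n / (1 - 1 / 2)) atTop (𝓝 0) := by
        have := ((tendsto_pow_atTop_nhds_zero_of_lt_one (r := (1 / 2 : ℝ)) (by norm_num)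
          (by norm_num)).const_mul 1).div_const (1 - 1 / 2)
        simpa using this
      filter_upwards [this.eventually (gt_mem_nhds hε)] with n hn x
      rw [dist_comm]
      exact (dist_le_of_le_geometric_of_tendsto (1 / 2) 1 (by norm_num) (hstep i x) (hh x i)
        n).trans_lt hn
    refine hu.continuous (Frequently.of_forall fun n => ?_)
    exact (continuous_apply i).comp (s _).continuous_toFun
  have hmem : ∀ m n, m ≤ n → ∀ x, (x, (s n).toFun x) ∈ (s m).constraint := fun m n hmn x =>
    hcon hmn ((s n).graph_mem x)
  have hconst : ∀ i n, i < n → ∀ x ∈ (s n).fixed, h x i = (s n).toFun x i := by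
    intro i n hin x hx
    refine tendsto_nhds_unique (htail x i) (tendsto_const_nhds.congr' ?_)
    filter_upwards [eventually_ge_atTop n] with k hk
    induction k, hk using Nat.le_induction with
    | base => rfl
    | succ k hk ih => rw [ih, (hs k).eq_of_mem x (hfixed hk hx) i (hin.trans_le hk)]
  refine ⟨h, hcont, fun m x hx => ?_, fun m x hx => ?_, fun m x hx t ht ε hε => ?_⟩
  · refine (half_pos ((hs m).pos_of_mem x hx)).trans_le (ge_of_tendsto (htail x m) ?_)
    filter_upwards [eventually_ge_atTop (m + 1)] with n hn
    exact ((hs m).lt_of_mem x _ (hmem _ _ hn x) hx).le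
  · refine le_of_tendsto (htail x m) ?_
    filter_upwards [eventually_ge_atTop (m + 1)] with n hn
    exact ((hs m).neg_of_notMem x _ (hmem _ _ hn x) hx).le
  · have hev : ∀ᶠ n in atTop, ∀ i ∈ Iio m, |(s n).toFun x i - h x i| < ε / 2 := by
      refine (finite_Iio m).eventually_all.2 fun i _ => ?_
      exact (Metric.tendsto_nhds.1 (htail x i)) _ (half_pos hε)
    -- The limit values at x need not satisfy the open constraint of stage m + 1, but those of a
    -- late stage n do, and they are within ε / 2 of the limit.
    obtain ⟨n, hn, hpos, hclose⟩ := ((eventually_ge_atTop (m + 1)).and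
      (((htail x m).eventually (lt_mem_nhds hx)).and hev)).exists
    obtain ⟨b, hb, hbF, hbs, hbt⟩ := (hs m).approx x _ (hmem _ _ hn x) hpos.le t ht _
      (half_pos hε)
    refine ⟨b, hb, fun k => ⟨fun i hi => ?_, ?_⟩, fun i hi => ?_⟩
    · rw [hconst i (m + 1) (by omega) _ (hbF k)]
      have h1 := (hbt k).1 i hi
      have h2 := hclose i hi
      have h3 := abs_sub_le ((s (m + 1)).toFun (b k) i) ((s n).toFun x i) (h x i)
      linarith
    · rw [hconst m (m + 1) (by omega) _ (hbF k)]
      exact (hbt k).2.trans (half_lt_self hε)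
    · refine squeeze_zero_norm (fun k => ?_) hbs
      have hk : b k ∈ (s i).fixed := hfixed hi (hbF k)
      rw [hconst i (i + 1) (by omega) _ (hfixed (Nat.le_succ i) hk), Real.norm_eq_abs]
      exact ((hs i).abs_le_scale _ hk).trans (hscale hi _)

end Coordinates

/-! ### Functions generating the topology. -/

section BasicFunctions

variable {X : Type*}

/-- The retraction of the real line onto the unit interval. -/
noncomputable def clip (t : ℝ) : ℝ := max 0 (min 1 t)

theorem continuous_clip : Continuous clip := by unfold clip; fun_prop

theorem clip_mem (t : ℝ) : clip t ∈ Icc (0 : ℝ) 1 :=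
  ⟨le_max_left _ _, max_le zero_le_one (min_le_left _ _)⟩

theorem clip_of_mem {t : ℝ} (ht : t ∈ Icc (0 : ℝ) 1) : clip t = t := by
  rw [clip, min_eq_right ht.2, max_eq_right ht.1]

theorem clip_of_nonpos {t : ℝ} (ht : t ≤ 0) : clip t = 0 :=
  max_eq_left ((min_le_right _ _).trans ht)

theorem clip_of_one_le {t : ℝ} (ht : 1 ≤ t) : clip t = 1 := by
  rw [clip, min_eq_left ht, max_eq_right zero_le_one]

theorem clip_pos {t : ℝ} : 0 < clip t ↔ 0 < t := by simp [clip]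

theorem abs_clip_sub_le (a b : ℝ) : |clip a - clip b| ≤ |a - b| := by
  unfold clip
  rw [max_comm 0, max_comm 0, min_comm 1, min_comm 1]
  refine (abs_max_sub_max_le_abs _ _ _).trans ((abs_min_sub_min_le_max _ _ _ _).trans ?_)
  simp

theorem exists_pos_iff_mem [MetricSpace X] {B : Set X} (hB : IsOpen B) :
    ∃ g : X → ℝ, Continuous g ∧ (∀ x, g x ∈ Icc (0 : ℝ) 1) ∧ ∀ x, 0 < g x ↔ x ∈ B := by
  rcases Bᶜ.eq_empty_or_nonempty with h | h
  · refine ⟨fun _ => 1, continuous_const, fun _ => ⟨zero_le_one, le_rfl⟩, fun x => ?_⟩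
    rw [compl_empty_iff] at h
    simp [h]
  · refine ⟨fun x => clip (Metric.infDist x Bᶜ),
      continuous_clip.comp (Metric.continuous_infDist_pt _), fun x => clip_mem _, fun x => ?_⟩
    rw [clip_pos, ← hB.isClosed_compl.notMem_iff_infDist_pos h, notMem_compl_iff]

theorem exists_nat_basis (X : Type*) [TopologicalSpace X] [SecondCountableTopology X]
    [Nonempty X] :
    ∃ B : ℕ → Set X, (∀ n, IsOpen (B n)) ∧ ∀ x, ∀ W ∈ 𝓝 x, ∃ n, x ∈ B n ∧ B n ⊆ W := by
  have hb := isBasis_countableBasis X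
  obtain ⟨B, hB⟩ := (countable_countableBasis X).exists_eq_range (by
    obtain ⟨x⟩ := ‹Nonempty X›
    obtain ⟨V, hV, -⟩ := hb.mem_nhds_iff.1 (univ_mem : univ ∈ 𝓝 x)
    exact ⟨V, hV⟩)
  refine ⟨B, fun n => hb.isOpen (hB ▸ mem_range_self n), fun x W hW => ?_⟩
  obtain ⟨V, hV, hx, hVW⟩ := hb.mem_nhds_iff.1 hW
  rw [hB] at hV
  obtain ⟨n, rfl⟩ := hV
  exact ⟨n, hx, hVW⟩

theorem isClosed_nonLocallyCompactPoints (X : Type*) [TopologicalSpace X] :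
    IsClosed (nonLocallyCompactPoints X) := by
  rw [← isOpen_compl_iff, isOpen_iff_mem_nhds]
  intro x hx
  simp only [nonLocallyCompactPoints, mem_compl_iff, mem_ofPred_eq, not_forall, not_not] at hx
  obtain ⟨C, hC, hcomp⟩ := hx
  filter_upwards [eventually_mem_nhds_iff.2 hC] with y hy h
  exact h C hy hcomp

/-- Functions with relatively compact supports that generate the topology at the points with
compact neighbourhoods. -/
theorem exists_compactly_supported [MetricSpace X] [SeparableSpace X] [Nonempty X] :
    ∃ S : X → ℕ → ℝ, Continuous S ∧ (∀ x j, S x j ∈ Icc (0 : ℝ) 1) ∧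
      (∀ j, ∃ C, IsCompact C ∧ ∀ x, S x j ≠ 0 → x ∈ C) ∧
      ∀ x ∉ nonLocallyCompactPoints X, ∀ W ∈ 𝓝 x, ∃ j, 0 < S x j ∧ ∀ z, 0 < S z j → z ∈ W := by
  classical
  have := UniformSpace.secondCountable_of_separable X
  obtain ⟨B, hB, hbasis⟩ := exists_nat_basis X
  choose g hg hg01 hgB using fun n => exists_pos_iff_mem (hB n)
  have key : ∀ x j, g j x ≠ 0 → x ∈ B j := fun x j h =>
    (hgB j x).1 ((hg01 j x).1.lt_of_ne' h)
  refine ⟨fun x j => if IsCompact (closure (B j)) then g j x else 0,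
    continuous_pi fun j => ?_, fun x j => ?_, fun j => ?_, fun x hx W hW => ?_⟩
  · split_ifs
    exacts [hg j, continuous_const]
  · dsimp only
    split_ifs
    exacts [hg01 j x, ⟨le_rfl, zero_le_one⟩]
  · by_cases hc : IsCompact (closure (B j))
    · refine ⟨_, hc, fun x hx => subset_closure (key x j ?_)⟩
      simpa [hc] using hx
    · exact ⟨∅, isCompact_empty, fun x hx => by simp [hc] at hx⟩
  · simp only [nonLocallyCompactPoints, mem_ofPred_eq, not_forall, not_not] at hx
    obtain ⟨C, hC, hcomp⟩ := hx
    obtain ⟨j, hj, hsub⟩ := hbasis x _ (inter_mem hC hW)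
    have hc : IsCompact (closure (B j)) :=
      hcomp.of_isClosed_subset isClosed_closure
        (closure_minimal (hsub.trans inter_subset_left) hcomp.isClosed)
    refine ⟨j, ?_, fun z hz => ?_⟩
    · simpa [hc] using (hgB j x).2 hj
    · simp only [hc, if_true] at hz
      exact (hsub ((hgB j z).1 hz)).2

/-- Coordinate functions as in `exists_coordinates` that generate the topology at the points
without compact neighbourhoods. -/
theorem exists_generating_coordinates [MetricSpace X] [SeparableSpace X] [Nonempty X]
    [∀ x : X, (𝓝[≠] x).NeBot] :
    ∃ h : X → ℕ → ℝ, Continuous h ∧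
      (∀ x ∈ nonLocallyCompactPoints X, ∀ W ∈ 𝓝 x, ∃ m, 0 < h x m ∧ ∀ z, 0 < h z m → z ∈ W) ∧
      ∀ m x, 0 < h x m → ∀ t ∈ Icc (0 : ℝ) 1, ∀ ε > 0,
        ∃ b : ℕ → X, (LocallyFinite fun n => ({b n} : Set X)) ∧
          (∀ n, (∀ i < m, |h (b n) i - h x i| < ε) ∧ |h (b n) m - t| < ε) ∧
          ∀ i > m, Tendsto (fun n => h (b n) i) atTop (𝓝 0) := by
  have := UniformSpace.secondCountable_of_separable X
  obtain ⟨B, hB, hbasis⟩ := exists_nat_basis X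
  choose g hg hg01 hgB using fun n => exists_pos_iff_mem (hB n)
  -- The index m codes a pair (n, k): the basic open set B n is exhausted by closed sets, because K
  -- has to be closed.
  obtain ⟨h, hcont, hpos, hneg, happ⟩ := exists_coordinates
    (K := fun m => nonLocallyCompactPoints X ∩
      {x | 1 / ((m.unpair.2 : ℝ) + 1) ≤ g m.unpair.1 x})
    (U := fun m => B m.unpair.1)
    (fun m => (isClosed_nonLocallyCompactPoints X).inter (isClosed_le continuous_const (hg _)))
    (fun m => inter_subset_left) (fun m => hB _)
    (fun m x hx => (hgB _ x).1 (lt_of_lt_of_le Nat.one_div_pos_of_nat hx.2))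
  refine ⟨h, hcont, fun x hx W hW => ?_, happ⟩
  obtain ⟨n, hxn, hnW⟩ := hbasis x W hW
  obtain ⟨k, hk⟩ := exists_nat_one_div_lt ((hgB n x).2 hxn)
  refine ⟨n.pair k, hpos _ x ⟨hx, by simpa using hk.le⟩, fun z hz => hnW ?_⟩
  by_contra hzB
  exact absurd hz (not_lt.2 (hneg (n.pair k) z (by simpa using hzB)))

end BasicFunctions

/-! ### Truncated sequences and the path through them. -/

section Truncation

/-- The sequence `p` with the coordinate `m` multiplied by `τ` and with zeros afterwards. -/
noncomputable def trunc (m : ℕ) (τ : ℝ) (p : ℕ → ℝ) : ℕ → ℝ := fun i =>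
  if i < m then p i else if i = m then τ * p m else 0

theorem continuous_trunc (m : ℕ) (τ : ℝ) : Continuous (trunc m τ) := by
  refine continuous_pi fun i => ?_
  unfold trunc
  split_ifs <;> fun_prop

/-- A function that rises from zero to one on the interval from `i / (i + 1)` to
`(i + 1) / (i + 2)`. -/
noncomputable def ramp (i : ℕ) (s : ℝ) : ℝ := clip (((i : ℝ) + 2) * (((i : ℝ) + 1) * s - i))

theorem continuous_ramp (i : ℕ) : Continuous (ramp i) :=
  continuous_clip.comp (by fun_prop)

theorem ramp_eq_one {i : ℕ} {s : ℝ} (h : (i : ℝ) + 1 ≤ ((i : ℝ) + 2) * s) : ramp i s = 1 := by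
  refine clip_of_one_le ?_
  have : (0 : ℝ) ≤ i := Nat.cast_nonneg i
  nlinarith

theorem ramp_eq_zero {i : ℕ} {s : ℝ} (h : ((i : ℝ) + 1) * s ≤ i) : ramp i s = 0 := by
  refine clip_of_nonpos (mul_nonpos_of_nonneg_of_nonpos (by positivity) (by linarith))

/-- The rising intervals of consecutive ramps abut, so at most one coordinate is under way: m is the
least index with s ≤ (m + 1) / (m + 2). -/
theorem exists_ramp_eq_trunc {s : ℝ} (hs1 : s < 1) (p : ℕ → ℝ) :
    ∃ m, ∃ τ ∈ Icc (0 : ℝ) 1, (fun i => ramp i s * p i) = trunc m τ p := by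
  classical
  have hex : ∃ m : ℕ, ((m : ℝ) + 2) * s ≤ m + 1 := by
    obtain ⟨m, hm⟩ := exists_nat_one_div_lt (sub_pos.2 hs1)
    refine ⟨m, ?_⟩
    rw [div_lt_iff₀ (by positivity)] at hm
    nlinarith
  have hmono : ∀ {i j : ℕ}, i ≤ j → ((i : ℝ) + 2) * s ≤ i + 1 → ((j : ℝ) + 2) * s ≤ j + 1 := by
    intro i j hij h
    have : (i : ℝ) ≤ j := by exact_mod_cast hij
    nlinarith
  refine ⟨Nat.find hex, ramp (Nat.find hex) s, clip_mem _, ?_⟩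
  have hspec := Nat.find_spec hex
  have hmin := fun i (hi : i < Nat.find hex) => Nat.find_min hex hi
  generalize Nat.find hex = m at hspec hmin
  funext i
  unfold trunc
  rcases lt_trichotomy i m with hi | rfl | hi
  · rw [if_pos hi, ramp_eq_one (not_le.1 (hmin i hi)).le, one_mul]
  · simp
  · rw [if_neg hi.not_gt, if_neg hi.ne', ramp_eq_zero, zero_mul]
    obtain ⟨j, rfl⟩ : ∃ j, i = j + 1 := ⟨i - 1, by omega⟩
    have := hmono (Nat.le_of_lt_succ hi) hspec
    push_cast
    linarith

end Truncation

/-! ### The compactification. -/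

section Construction

variable {X : Type*}

theorem exists_compactification [MetricSpace X] [SeparableSpace X] [Nonempty X]
    [∀ x : X, (𝓝[≠] x).NeBot] (hX : ¬ CompactSpace X) :
    ∃ (Y : Type) (_ : TopologicalSpace Y) (e : X → Y) (o : Y), IsDenseEmbedding e ∧
      CompactSpace Y ∧ T2Space Y ∧ MetrizableSpace Y ∧ o ∉ range e ∧
      ∀ a ∈ closure (range e)ᶜ, ∃ γ : Path o a, ∀ t, γ t ∈ range e → γ t = a := by
  obtain ⟨S, hS, hS01, hSC, hSL⟩ := exists_compactly_supported (X := X)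
  obtain ⟨h, hh, hhN, happ⟩ := exists_generating_coordinates (X := X)
  let Φ : X → (ℕ → ℝ) × (ℕ → ℝ) := fun x => (fun i => clip (h x i), S x)
  have hΦ : Continuous Φ := by
    refine Continuous.prodMk (continuous_pi fun i => ?_) hS
    exact continuous_clip.comp ((continuous_apply i).comp hh)
  have hgen : ∀ x, ∀ W ∈ 𝓝 x, ∃ c : (ℕ → ℝ) × (ℕ → ℝ) → ℝ, Continuous c ∧ 0 < c (Φ x) ∧
      ∀ z, 0 < c (Φ z) → z ∈ W := by
    intro x W hW
    by_cases hx : x ∈ nonLocallyCompactPoints X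
    · obtain ⟨m, hm, hmW⟩ := hhN x hx W hW
      exact ⟨fun y => y.1 m, by fun_prop, clip_pos.2 hm, fun z hz => hmW z (clip_pos.1 hz)⟩
    · obtain ⟨j, hj, hjW⟩ := hSL x hx W hW
      exact ⟨fun y => y.2 j, by fun_prop, hj, hjW⟩
  have hemb : IsEmbedding Φ := by
    refine IsInducing.isEmbedding (isInducing_iff_nhds.2 fun x => le_antisymm
      hΦ.continuousAt.le_comap fun W hW => ?_)
    obtain ⟨c, hc, hcx, hcW⟩ := hgen x W hW
    exact mem_comap.2 ⟨{y | 0 < c y}, (isOpen_lt continuous_const hc).mem_nhds hcx, hcW⟩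
  let Z : Set ((ℕ → ℝ) × (ℕ → ℝ)) := closure (range Φ)
  have hZ01 : Z ⊆ (univ.pi fun _ => Icc (0 : ℝ) 1) ×ˢ (univ.pi fun _ => Icc (0 : ℝ) 1) := by
    refine closure_minimal ?_ ((isClosed_set_pi fun _ _ => isClosed_Icc).prod
      (isClosed_set_pi fun _ _ => isClosed_Icc))
    rintro _ ⟨x, rfl⟩
    exact ⟨fun i _ => clip_mem _, fun i _ => hS01 x i⟩
  have hZcomp : IsCompact Z := by
    refine IsCompact.of_isClosed_subset ?_ isClosed_closure hZ01
    exact (isCompact_univ_pi fun _ => isCompact_Icc).prod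
      (isCompact_univ_pi fun _ => isCompact_Icc)
  let R : Set ((ℕ → ℝ) × (ℕ → ℝ)) := Z ∩ {y | y.2 = 0}
  have hRcl : IsClosed R := isClosed_closure.inter (isClosed_eq continuous_snd continuous_const)
  -- Where the coordinate j of the second factor is nonzero, the image of X lies in the image of a
  -- compact set, which is closed; so no new limits arise there.
  have hZR : ∀ y ∈ Z, y ∉ range Φ → y ∈ R := by
    intro y hy hyX
    refine ⟨hy, ?_⟩
    by_contra hne
    obtain ⟨j, hj⟩ := Function.ne_iff.1 hne
    obtain ⟨C, hC, hCS⟩ := hSC j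
    have hopen : IsOpen {z : (ℕ → ℝ) × (ℕ → ℝ) | z.2 j ≠ 0} :=
      isOpen_ne_fun (by fun_prop) continuous_const
    have h1 : y ∈ closure ({z | z.2 j ≠ 0} ∩ range Φ) := hopen.inter_closure ⟨hj, hy⟩
    have h2 : closure ({z | z.2 j ≠ 0} ∩ range Φ) ⊆ Φ '' C := by
      refine closure_minimal ?_ (hC.image hΦ).isClosed
      rintro _ ⟨hz, x, rfl⟩
      exact ⟨x, hCS x hz, rfl⟩
    exact hyX (image_subset_range _ _ (h2 h1))
  have happrox : ∀ m x, 0 < h x m → ∀ τ ∈ Icc (0 : ℝ) 1, (trunc m τ (Φ x).1, 0) ∈ R := by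
    intro m x hx τ hτ
    refine ⟨?_, rfl⟩
    have hmem := clip_mem (h x m)
    have hτx : τ * clip (h x m) ∈ Icc (0 : ℝ) 1 :=
      ⟨mul_nonneg hτ.1 hmem.1, mul_le_one₀ hτ.2 hmem.1 hmem.2⟩
    have hpt : ∀ k : ℕ, ∃ z, (∀ i ≤ k, |(Φ z).1 i - trunc m τ (Φ x).1 i| < 1 / ((k : ℝ) + 1)) ∧
        ∀ j ≤ k, (Φ z).2 j = 0 := by
      intro k
      have hk : (0 : ℝ) < 1 / ((k : ℝ) + 1) := Nat.one_div_pos_of_nat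
      obtain ⟨b, hb, hbx, hb0⟩ := happ m x hx _ hτx _ hk
      have h1 : ∀ᶠ n in atTop, ∀ i ∈ Iic k, i > m → |h (b n) i| < 1 / ((k : ℝ) + 1) := by
        refine (finite_Iic k).eventually_all.2 fun i _ => ?_
        by_cases hi : i > m
        · filter_upwards [Metric.tendsto_nhds.1 (hb0 i hi) _ hk] with n hn _
          simpa using hn
        · exact Eventually.of_forall fun n h => absurd h hi
      -- A locally finite sequence leaves the compact supports.
      have h2 : ∀ᶠ n in atTop, ∀ j ∈ Iic k, S (b n) j = 0 := by
        refine (finite_Iic k).eventually_all.2 fun j _ => ?_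
        obtain ⟨C, hC, hCS⟩ := hSC j
        have hfin := hb.finite_nonempty_inter_compact hC
        rw [← Nat.cofinite_eq_atTop]
        refine eventually_cofinite.2 (hfin.subset fun n hn => ?_)
        exact ⟨b n, rfl, hCS _ hn⟩
      obtain ⟨n, hn1, hn2⟩ := (h1.and h2).exists
      refine ⟨b n, fun i hi => ?_, hn2⟩
      change |clip (h (b n) i) - trunc m τ (fun i => clip (h x i)) i| < _
      unfold trunc
      rcases lt_trichotomy i m with him | rfl | him
      · rw [if_pos him]
        exact (abs_clip_sub_le _ _).trans_lt ((hbx n).1 i him)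
      · rw [if_neg (lt_irrefl i), if_pos rfl, ← clip_of_mem hτx]
        exact (abs_clip_sub_le _ _).trans_lt (hbx n).2
      · rw [if_neg him.not_gt, if_neg him.ne', ← clip_of_nonpos le_rfl]
        refine (abs_clip_sub_le _ _).trans_lt ?_
        simpa using hn1 i hi him
    choose z hz hz0 using hpt
    refine mem_closure_of_tendsto (f := fun k => Φ (z k)) (b := atTop) ?_
      (Eventually.of_forall fun k => mem_range_self _)
    refine Tendsto.prodMk_nhds (tendsto_pi_nhds.2 fun i => ?_) (tendsto_pi_nhds.2 fun j => ?_)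
    · rw [tendsto_iff_dist_tendsto_zero]
      refine squeeze_zero' (Eventually.of_forall fun _ => dist_nonneg) ?_
        tendsto_one_div_add_atTop_nhds_zero_nat
      filter_upwards [eventually_ge_atTop i] with k hk
      exact (hz k i hk).le
    · refine tendsto_const_nhds.congr' ?_
      filter_upwards [eventually_ge_atTop j] with k hk
      exact (hz0 k j hk).symm
  have htrunc_pos : ∀ y ∈ Z, ∀ m, 0 < y.1 m → ∀ τ ∈ Icc (0 : ℝ) 1, (trunc m τ y.1, 0) ∈ R := by
    intro y hy m hm τ hτ
    have hopen : IsOpen {z : (ℕ → ℝ) × (ℕ → ℝ) | 0 < z.1 m} :=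
      isOpen_lt continuous_const (by fun_prop)
    have h1 : y ∈ closure ({z | 0 < z.1 m} ∩ range Φ) := hopen.inter_closure ⟨hm, hy⟩
    have hcont : Continuous fun z : (ℕ → ℝ) × (ℕ → ℝ) => (trunc m τ z.1, (0 : ℕ → ℝ)) :=
      ((continuous_trunc m τ).comp continuous_fst).prodMk continuous_const
    have h2 : closure ({z | 0 < z.1 m} ∩ range Φ) ⊆
        (fun z : (ℕ → ℝ) × (ℕ → ℝ) => (trunc m τ z.1, (0 : ℕ → ℝ))) ⁻¹' R := by
      refine closure_minimal ?_ (hRcl.preimage hcont)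
      rintro _ ⟨hz, x, rfl⟩
      exact happrox m x (clip_pos.1 hz) τ hτ
    exact h2 h1
  have hRne : R.Nonempty := by
    by_contra hemp
    refine hX (isCompact_univ_iff.1 ((hemb.isCompact_iff).2 ?_))
    rw [image_univ]
    have : Z = range Φ := subset_closure.antisymm' fun y hy => by
      by_contra hyX
      exact hemp ⟨y, hZR y hy hyX⟩
    exact this ▸ hZcomp
  -- Truncating a point of R at its first nonzero coordinate, with factor 0, gives the origin.
  have hzero : (0 : (ℕ → ℝ) × (ℕ → ℝ)) ∈ R := by
    classical
    obtain ⟨y, hy⟩ := hRne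
    by_cases hy0 : ∃ m, y.1 m ≠ 0
    · have hm : 0 < y.1 (Nat.find hy0) :=
        ((hZ01 hy.1).1 _ (mem_univ _)).1.lt_of_ne' (Nat.find_spec hy0)
      have := htrunc_pos y hy.1 _ hm 0 ⟨le_rfl, zero_le_one⟩
      convert this using 1
      refine Prod.ext (funext fun i => ?_) rfl
      change 0 = trunc _ _ _ i
      unfold trunc
      split_ifs with hi
      · exact (not_not.1 (Nat.find_min hy0 hi)).symm
      · simp
      · rfl
    · push Not at hy0
      have : y = 0 := Prod.ext (funext hy0) hy.2
      exact this ▸ hy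
  -- When the coordinate m of y vanishes, truncation at m is truncation at m - 1 with factor 1, or
  -- the origin if m = 0.
  have htrunc : ∀ y ∈ Z, ∀ m, ∀ τ ∈ Icc (0 : ℝ) 1, (trunc m τ y.1, 0) ∈ R := by
    intro y hy m
    induction m with
    | zero =>
      intro τ hτ
      rcases ((hZ01 hy).1 0 (mem_univ _)).1.lt_or_eq with hpos | h0
      · exact htrunc_pos y hy 0 hpos τ hτ
      · convert hzero using 1
        refine Prod.ext (funext fun i => ?_) rfl
        simp [trunc, ← h0]
    | succ m ih =>
      intro τ hτ
      rcases ((hZ01 hy).1 (m + 1) (mem_univ _)).1.lt_or_eq with hpos | h0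
      · exact htrunc_pos y hy (m + 1) hpos τ hτ
      · convert ih 1 ⟨zero_le_one, le_rfl⟩ using 2
        funext i
        unfold trunc
        rcases lt_trichotomy i m with hi | rfl | hi
        · rw [if_pos hi, if_pos (by omega)]
        · simp
        · simp [← h0, hi.not_gt, hi.ne', Nat.not_lt.2 (Nat.succ_le_of_lt hi)]
  have hnot : ∀ (m : ℕ) (τ : ℝ) (p : ℕ → ℝ), (trunc m τ p, (0 : ℕ → ℝ)) ∉ range Φ := by
    rintro m τ p ⟨x, hx⟩
    have hx1 : ∀ i, clip (h x i) = trunc m τ p i := fun i => congrArg (fun y => y.1 i) hx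
    have hx2 : ∀ j, S x j = 0 := fun j => congrArg (fun y => y.2 j) hx
    have hxN : x ∈ nonLocallyCompactPoints X := by
      by_contra hxN
      obtain ⟨j, hj, -⟩ := hSL x hxN univ univ_mem
      exact hj.ne' (hx2 j)
    have hnear : ∀ i, 0 < h x i → ∃ z ≠ x, 0 < h z i := by
      intro i hi
      have hev : ∀ᶠ z in 𝓝[≠] x, 0 < h z i := by
        refine nhdsWithin_le_nhds (IsOpen.mem_nhds ?_ hi)
        exact isOpen_lt continuous_const ((continuous_apply i).comp hh)
      obtain ⟨z, hz, hzx⟩ := (hev.and self_mem_nhdsWithin).exists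
      exact ⟨z, hzx, hz⟩
    -- Removing from X a second point of positivity z i for each i ≤ m leaves a neighbourhood of x
    -- that contains no positivity set of these coordinates. A coordinate that is positive at x and
    -- supported there thus has index above m, where the truncation is zero.
    choose! z hzx hz using hnear
    obtain ⟨k, hk, hkW⟩ := hhN x hxN (⋂ i ∈ {i ∈ Iic m | 0 < h x i}, {z i}ᶜ)
      ((biInter_mem ((finite_Iic m).subset (sep_subset _ _))).2 fun i hi =>
        isOpen_compl_singleton.mem_nhds (hzx i hi.2).symm)
    have hkm : m < k := by
      by_contra! hle
      exact mem_iInter₂.1 (hkW (z k) (hz k hk)) k ⟨hle, hk⟩ rfl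
    have := hx1 k
    rw [trunc, if_neg hkm.not_gt, if_neg hkm.ne'] at this
    exact (clip_pos.2 hk).ne' this
  have hzero_trunc : (0 : (ℕ → ℝ) × (ℕ → ℝ)) = (trunc 0 0 0, 0) := by
    refine Prod.ext (funext fun i => ?_) rfl
    simp [trunc]
  have hmaps : ∀ x, Φ x ∈ Z := fun x => subset_closure (mem_range_self x)
  have hrange : ∀ y : Z, y ∈ range (codRestrict Φ Z hmaps) ↔ (y : (ℕ → ℝ) × (ℕ → ℝ)) ∈ range Φ := by
    intro y
    constructor
    · rintro ⟨x, rfl⟩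
      exact ⟨x, rfl⟩
    · rintro ⟨x, hx⟩
      exact ⟨x, Subtype.ext hx⟩
  refine ⟨Z, inferInstance, codRestrict Φ Z hmaps, ⟨0, hzero.1⟩, ?_,
    isCompact_iff_compactSpace.1 hZcomp, inferInstance, inferInstance, ?_, ?_⟩
  · refine { (hemb.codRestrict Z hmaps) with dense := fun y => ?_ }
    rw [closure_subtype]
    convert y.2 using 2
    ext z
    constructor
    · rintro ⟨_, ⟨x, rfl⟩, rfl⟩
      exact ⟨x, rfl⟩
    · rintro ⟨x, rfl⟩
      exact ⟨_, ⟨x, rfl⟩, rfl⟩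
  · rw [hrange]
    change (0 : (ℕ → ℝ) × (ℕ → ℝ)) ∉ range Φ
    rw [hzero_trunc]
    exact hnot _ _ _
  · intro y hy
    have hyR : (y : (ℕ → ℝ) × (ℕ → ℝ)) ∈ R := by
      have : closure (range (codRestrict Φ Z hmaps))ᶜ ⊆ Subtype.val ⁻¹' R :=
        closure_minimal (fun y hy => hZR y y.2 fun h => hy ((hrange y).2 h))
          (hRcl.preimage continuous_subtype_val)
      exact this hy
    have hpath : ∀ t : unitInterval, ((fun i => ramp i t * y.1.1 i, 0) : (ℕ → ℝ) × (ℕ → ℝ)) ∈ R ∧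
        (((fun i => ramp i t * y.1.1 i, 0) : (ℕ → ℝ) × (ℕ → ℝ)) ∈ range Φ → t = 1) := by
      intro t
      rcases t.2.2.lt_or_eq with ht | ht
      · obtain ⟨m, τ, hτ, heq⟩ := exists_ramp_eq_trunc ht y.1.1
        rw [heq]
        exact ⟨htrunc y y.2 m τ hτ, fun h => absurd h (hnot _ _ _)⟩
      · have ht1 : t = 1 := Subtype.ext ht
        refine ⟨?_, fun _ => ht1⟩
        convert hyR using 1
        refine Prod.ext (funext fun i => ?_) hyR.2.symm
        have : ramp i t = 1 := ramp_eq_one (by rw [ht]; linarith)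
        simp [this]
    refine ⟨⟨⟨fun t => ⟨(fun i => ramp i t * y.1.1 i, 0), (hpath t).1.1⟩, ?_⟩, ?_, ?_⟩,
      fun t ht => ?_⟩
    · refine Continuous.subtype_mk ?_ _
      refine Continuous.prodMk (continuous_pi fun i => ?_) continuous_const
      exact ((continuous_ramp i).comp continuous_subtype_val).mul continuous_const
    · refine Subtype.ext (Prod.ext (funext fun i => ?_) rfl)
      have : ramp i 0 = 0 := ramp_eq_zero (by simp)
      simp [this]
    · refine Subtype.ext (Prod.ext (funext fun i => ?_) hyR.2.symm)
      have : ramp i 1 = 1 := ramp_eq_one (by linarith)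
      simp [this]
    · rw [(hpath t).2 ((hrange _).1 ht)]
      exact Path.target _

end Construction

end Continua

/-! ### Assembly of the theorem. -/

theorem theorem4p6 {X : Type u} [TopologicalSpace X] [SeparableSpace X] [MetrizableSpace X]
    (hX : Continua.IsCutPointSpace X) :
    ∃ (Y : Type u) (_ : TopologicalSpace Y) (e : X → Y),
      IsDenseEmbedding e ∧
      Continua.IsContinuum Y ∧
      MetrizableSpace Y ∧
      Continua.IsReducible Y ∧
      (∀ y : Y, ¬ Continua.IsCutPoint y) ∧
      IsPathConnected (range e)ᶜ := by
  let _ := metrizableSpaceMetric X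
  have := hX.connected
  obtain ⟨x⟩ : Nonempty X := inferInstance
  obtain ⟨A, B, hAB⟩ := (hX.cut x).exists_separates
  have : Nontrivial X := by
    obtain ⟨z, hz⟩ := hAB.nonempty_left
    exact ⟨x, z, fun h => hAB.notMem_left (h ▸ hz)⟩
  have hcomp : ¬ CompactSpace X := fun _ =>
    hAB.not_isCompact hX.cut hAB.isClosed_insert.isCompact
  obtain ⟨Y₀, _, e₀, o₀, he₀, hY₀, _, _, ho₀, hpath₀⟩ := Continua.exists_compactification hcomp
  -- The compactification, a set of pairs of real sequences, is lifted to the universe of X.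
  let φ : Y₀ ≃ₜ ULift.{u} Y₀ := Homeomorph.ulift.symm
  let e : X → ULift.{u} Y₀ := φ ∘ e₀
  have he : IsDenseEmbedding e :=
    { φ.isEmbedding.comp he₀.isEmbedding with
      dense := φ.surjective.denseRange.comp he₀.dense φ.continuous }
  have hrange : ∀ y, φ y ∈ range e ↔ y ∈ range e₀ := fun y => by
    simp [e, φ.injective.eq_iff]
  have hpath : ∀ a ∈ closure (range e)ᶜ, ∃ γ : Path (φ o₀) a, ∀ t, γ t ∈ range e → γ t = a := by
    intro a ha
    obtain ⟨y, rfl⟩ := φ.surjective a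
    have hy : y ∈ closure (range e₀)ᶜ := by
      have : (range e₀)ᶜ = φ ⁻¹' (range e)ᶜ := by
        ext z
        simp only [mem_compl_iff, mem_preimage, hrange]
      rw [this, ← φ.preimage_closure]
      exact ha
    obtain ⟨γ, hγ⟩ := hpath₀ y hy
    exact ⟨γ.map φ.continuous, fun t ht => congrArg φ (hγ t ((hrange _).1 ht))⟩
  have hconn : IsPathConnected (range e)ᶜ := by
    refine ⟨φ o₀, fun h => ho₀ ((hrange _).1 h), fun {a} ha => ?_⟩
    obtain ⟨γ, hγ⟩ := hpath a (subset_closure ha)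
    exact ⟨γ, fun t ht => ha (hγ t ht ▸ ht)⟩
  have : CompactSpace (ULift.{u} Y₀) := φ.compactSpace
  have : T2Space (ULift.{u} Y₀) := φ.t2Space
  have : PreconnectedSpace (ULift.{u} Y₀) := DenseRange.preconnectedSpace he.dense he.continuous
  have : ConnectedSpace (ULift.{u} Y₀) := ⟨⟨φ o₀⟩⟩
  exact ⟨ULift.{u} Y₀, inferInstance, e, he, ⟨inferInstance, inferInstance, inferInstance⟩,
    φ.symm.isEmbedding.metrizableSpace, hX.isReducible he hpath hconn.isConnected,
    hX.not_isCutPoint he hconn.isConnected.isPreconnected, hconn⟩
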